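/- Let $m\ge 1$, write $S=S(z)=\sum_{i=1}^m|z_i|^2$ for $z\in\mathbb{C}^m$, and let $g$ be a real analytic function on (a neighbourhood of) $[0,\infty)$ with $$g_S(0)>0,\qquad \tfrac1S+g_S(S)>0,\qquad g_S(S)+S\,g_{SS}(S)>0\qquad (S>0).$$ Equip $\mathbb{C}^m\setminus\{0\}$ with the $U(m)$-invariant Kähler metric of the form $\omega=\sqrt{-1}\,\partial\bar\partial f(S)$, $f(S)=\log S+g(S)$, that is, with the Riemannian metric $\langle u,v\rangle=\mathrm{Re}\sum_{i,j}\frac{\partial^2 f(S)}{\partial z_i\partial\bar z_j}u_i\bar v_j$. For $R>0$ let $\Sigma_R=\{z\in\mathbb{C}^m: S(z)=R^2\}$, parametrized by $S^{2m-1}\ni x\mapsto Rx$. A mean curvature flow on $[0,T)$ is a smooth map $F:S^{2m-1}\times[0,T)\to\mathbb{C}^m\setminus\{0\}$ such that every $F_t=F(\cdot,t)$ is an immersion and $\partial_tF=Hn$, where $n$ is a unit normal field of $F_t$ and $H$ is the sum of the principal curvatures of $F_t$ with respect to $n$; $|A|^2$ denotes the sum of their squares. Then there is $\epsilon>0$ such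 that for every $R_0$ with $0<R_0<\epsilon$ there are a finite time $T>0$ and a mean curvature flow $F$ on $[0,T)$ with $F_0(x)=R_0x$ such that: 1. each $F_t(S^{2m-1})$, $t\in[0,T)$, is a hypersphere $\Sigma_{R(t)}$ with $R(t)>0$; 2. $F$ is the unique maximal mean curvature flow starting at $\Sigma_{R_0}$: every mean curvature flow $F'$ on an interval $[0,T')$ with $F'_0(x)=R_0x$ satisfies $T'\le T$ and $F'=F$ on $[0,T')$; 3. as $t\to T$, the flow collapses onto the exceptional divisor: let $\mathrm{Bl}_0\mathbb{C}^m=\{(z,[t])\in\mathbb{C}^m\times\mathbb{C}P^{m-1}: z_it_j-z_jt_i=0\}$ with projection $\pi_1(z,[t])=z$ and exceptional divisor $E=\pi_1^{-1}(0)$; then the compact sets $\pi_1^{-1}(F_t(S^{2m-1}))$ converge to $E$ (every open set containing $E$ contains them, and every open set meeting $E$ meets them, for all $t<T$ close enough to $T$); 4. the flow develops a singularity of Type I at time $T$: $\max|A(\cdot,t)|^2\to\infty$ as $t\to T$, and there is a constant $C>1$ with $\max_{p}|A(p,t)|^2\le \frac{C}{T-t}$ for all $t\in[0,T)$. -/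

import Mathlib

open Set Filter Topology
open scoped Manifold ContDiff LinearAlgebra.Projectivization

noncomputable section

namespace KahlerMCF

/-! ### Hypersurfaces and mean curvature flow in an open subset of a vector space -/

section Riemannian

variable {E : Type*} [NormedAddCommGroup E] [NormedSpace ℝ E]

/-- The Christoffel symbols of the first kind of a metric `G` on (an open subset of) a vector
space: `Γ_p(u, v; w) = (D_u G(v, w) + D_v G(u, w) - D_w G(u, v)) / 2`, so that the Levi-Civita
connection `∇` satisfies `G (∇_u W, w) = G (D_u W, w) + Γ_p(u, W; w)`. -/
def christoffel (G : E → E → E → ℝ) (p u v w : E) : ℝ :=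
  (fderiv ℝ (fun q => G q v w) p u + fderiv ℝ (fun q => G q u w) p v
    - fderiv ℝ (fun q => G q u v) p w) / 2

variable (d : ℕ) {N : Type*} [TopologicalSpace N] [ChartedSpace (EuclideanSpace ℝ (Fin d)) N]

/-- The differential of a map from a manifold to a vector space. -/
def diff (F : N → E) (p : N) (X : EuclideanSpace ℝ (Fin d)) : E :=
  mfderiv (𝓡 d) 𝓘(ℝ, E) F p X

/-- `ν` is a smooth field of `G`-unit normals along `F`. -/
structure IsUnitNormal (G : E → E → E → ℝ) (F ν : N → E) : Prop where
  smooth : ContMDiff (𝓡 d) 𝓘(ℝ, E) ∞ ν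
  unit : ∀ p, G (F p) (ν p) (ν p) = 1
  normal : ∀ (p : N) (X : EuclideanSpace ℝ (Fin d)), G (F p) (ν p) (diff d F p X) = 0

/-- The second fundamental form `Π_ν(X, Y) = - G (∇_X ν, dF Y) (= G (∇_X (dF Y), ν))` of the
immersion `F` with unit normal field `ν`, with `∇` the Levi-Civita connection of `G`. -/
def secondFundamentalForm (G : E → E → E → ℝ) (F ν : N → E) (p : N)
    (X Y : EuclideanSpace ℝ (Fin d)) : ℝ :=
  -(G (F p) (diff d ν p X) (diff d F p Y)
    + christoffel G (F p) (diff d F p X) (ν p) (diff d F p Y))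

/-- The matrix of the induced metric in the coordinate basis of the tangent space. -/
def inducedMetric (G : E → E → E → ℝ) (F : N → E) (p : N) : Matrix (Fin d) (Fin d) ℝ :=
  Matrix.of fun i j =>
    G (F p) (diff d F p (EuclideanSpace.single i 1)) (diff d F p (EuclideanSpace.single j 1))

/-- The matrix of the shape operator: its eigenvalues are the principal curvatures. -/
def shapeOperator (G : E → E → E → ℝ) (F ν : N → E) (p : N) : Matrix (Fin d) (Fin d) ℝ :=
  (inducedMetric d G F p)⁻¹ * Matrix.of fun i j =>
    secondFundamentalForm d G F ν p (EuclideanSpace.single i 1) (EuclideanSpace.single j 1)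

/-- The mean curvature: the sum of the principal curvatures. -/
def meanCurvature (G : E → E → E → ℝ) (F ν : N → E) (p : N) : ℝ :=
  (shapeOperator d G F ν p).trace

/-- `|A|²`: the sum of the squares of the principal curvatures. -/
def normSqA (G : E → E → E → ℝ) (F ν : N → E) (p : N) : ℝ :=
  (shapeOperator d G F ν p * shapeOperator d G F ν p).trace

/-- `F t`, `t ∈ [0, T)`, is a mean curvature flow in the open set `U` with metric `G`, and `ν t` is
the unit normal of `F t`. -/
structure IsMeanCurvatureFlow (U : Set E) (G : E → E → E → ℝ) (T : ℝ) (F ν : ℝ → N → E) :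
    Prop where
  smooth : ContMDiffOn ((𝓡 d).prod 𝓘(ℝ, ℝ)) 𝓘(ℝ, E) ∞ (fun q : N × ℝ => F q.2 q.1)
    (univ ×ˢ Ico 0 T)
  mem : ∀ t ∈ Ico 0 T, ∀ p, F t p ∈ U
  immersion : ∀ t ∈ Ico 0 T, ∀ p, Function.Injective (diff d (F t) p)
  unitNormal : ∀ t ∈ Ico 0 T, IsUnitNormal d G (F t) (ν t)
  evolution : ∀ t ∈ Ico 0 T, ∀ p,
    HasDerivWithinAt (fun s => F s p) (meanCurvature d G (F t) (ν t) p • ν t p) (Ico 0 T) t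

/-- `T` is a singular time: `max |A|²` blows up as `t → T`. -/
def IsSingularTime (G : E → E → E → ℝ) (T : ℝ) (F ν : ℝ → N → E) : Prop :=
  ∀ K : ℝ, ∀ᶠ t in 𝓝[<] T, ∃ p, K < normSqA d G (F t) (ν t) p

/-- The flow develops a singularity of Type I at time `T`. -/
def IsTypeISingularity (G : E → E → E → ℝ) (T : ℝ) (F ν : ℝ → N → E) : Prop :=
  IsSingularTime d G T F ν ∧
    ∃ C : ℝ, 1 < C ∧ ∀ t ∈ Ico 0 T, ∀ p, normSqA d G (F t) (ν t) p ≤ C / (T - t)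

end Riemannian

/-! ### Kähler metrics given by a potential on `ℂ^m` -/

/-- `ℂ^m` with its Hermitian norm. -/
abbrev Cm (m : ℕ) := EuclideanSpace ℂ (Fin m)

/-- The Wirtinger derivative `∂φ/∂z_i`. -/
def wirtinger {m : ℕ} (i : Fin m) (φ : Cm m → ℂ) (z : Cm m) : ℂ :=
  (fderiv ℝ φ z (EuclideanSpace.single i 1)
    - Complex.I * fderiv ℝ φ z (EuclideanSpace.single i Complex.I)) / 2

/-- The Wirtinger derivative `∂φ/∂z̄_i`. -/
def wirtingerBar {m : ℕ} (i : Fin m) (φ : Cm m → ℂ) (z : Cm m) : ℂ :=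
  (fderiv ℝ φ z (EuclideanSpace.single i 1)
    + Complex.I * fderiv ℝ φ z (EuclideanSpace.single i Complex.I)) / 2

/-- The Riemannian metric of the form `√-1 ∂∂̄ φ`, that is
`(u, v) ↦ Re ∑ i j, (∂²φ / ∂z_i ∂z̄_j) u_i v̄_j`. -/
def kahlerMetric {m : ℕ} (φ : Cm m → ℝ) (z u v : Cm m) : ℝ :=
  (∑ i, ∑ j, wirtinger i (wirtingerBar j fun w => (φ w : ℂ)) z
    * u i * (starRingEnd ℂ) (v j)).re

/-- `S = ∑ |z_i|²`. -/
def S {m : ℕ} (z : Cm m) : ℝ := ∑ i, ‖z i‖ ^ 2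

/-- The metric of `√-1 ∂∂̄ (log S + g(S))`. -/
def blowUpMetric (m : ℕ) (g : ℝ → ℝ) : Cm m → Cm m → Cm m → ℝ :=
  kahlerMetric fun z => Real.log (S z) + g (S z)

/-- The hypersphere `Σ_R = {S = R²}` in `ℂ^m`. -/
def hypersphere (m : ℕ) (R : ℝ) : Set (Cm m) := {z | S z = R ^ 2}

instance finrank_Cm (m : ℕ) [NeZero m] : Fact (Module.finrank ℝ (Cm m) = 2 * m - 1 + 1) :=
  ⟨by
    have h : 0 < m := Nat.pos_of_ne_zero (NeZero.ne m)
    have := finrank_real_of_complex (Cm m)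
    simp only [finrank_euclideanSpace, Fintype.card_fin] at this
    omega⟩

/-- The manifold `S^{2m-1}`. -/
abbrev UnitSphere (m : ℕ) := Metric.sphere (0 : Cm m) 1

/-! ### The blow up of `ℂ^m` at the origin -/

/-- The quotient topology on complex projective space. -/
instance projTopology (m : ℕ) : TopologicalSpace (ℙ ℂ (Cm m)) :=
  TopologicalSpace.coinduced (Projectivization.mk' ℂ) inferInstance

/-- `Bl₀ ℂ^m ⊆ ℂ^m × ℂP^{m-1}`, with the subspace topology. -/
abbrev BlowUp (m : ℕ) :=
  {q : Cm m × ℙ ℂ (Cm m) // ∀ i j, q.1 i * q.2.rep j - q.1 j * q.2.rep i = 0}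

/-- The projection `π₁ : Bl₀ ℂ^m → ℂ^m`. -/
def blowDown {m : ℕ} (q : BlowUp m) : Cm m := q.1.1

/-- The exceptional divisor. -/
def exceptionalDivisor (m : ℕ) : Set (BlowUp m) := blowDown ⁻¹' {0}

/-- Convergence of the sets `A t` to the set `B` as `t → T⁻`, in the Vietoris sense (which for
compact sets in a metrizable space is convergence in the Hausdorff distance). -/
def SetsConverge {X : Type*} [TopologicalSpace X] (A : ℝ → Set X) (T : ℝ) (B : Set X) : Prop :=
  (∀ O : Set X, IsOpen O → B ⊆ O → ∀ᶠ t in 𝓝[<] T, A t ⊆ O) ∧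
    ∀ O : Set X, IsOpen O → (B ∩ O).Nonempty → ∀ᶠ t in 𝓝[<] T, (A t ∩ O).Nonempty

end KahlerMCF

end

open KahlerMCF

/-! With `s = ‖z‖ ^ 2`, let `a`, `b`, `b'` be the first three derivatives of the potential `log s +
g s`, and put `l = a + s * b`, `l' = 2 * b + s * b'` (the derivative of `l`). The poles coming from
`log s` cancel in `l = g' + s g''` and in `l'`, while `a` keeps its pole `1 / s`. The sphere `‖z‖ ^
2 = s` has, up to the sign of the normal and a common factor `1 / √(l s)`, the principal curvature
`1 + s l' / l` in the Hopf direction `J z` and `l / a` in the remaining `d - 1` directions.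

Existence is therefore an ordinary differential equation `s' = -2 ρ(s)`. Since `l / a` vanishes at
`s = 0`, both `ρ` and `κ = s |A|²` extend analytically across `0` with value `1 / g'(0) > 0` there.
A small sphere thus reaches `s = 0` at a finite time `T` with `s ≥ c (T - t)`, and `|A|² = κ(s) / s`
blows up at the Type I rate (`exists_solution_reaching_zero`, `isTypeISingularity_of_eq_div`).

Uniqueness is a barrier argument rather than parabolic theory. At a spatial extremum of `‖F‖ ^ 2`
the unit normal is radial, and the mean curvature vector differs from that of the sphere through the
point by the trace of a Hessian of known sign (`exists_meanCurvature_smul_of_critical`). The maximum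
principle `nonpos_of_deriv_le_at_max` then forces `‖F‖ ^ 2 = s(t)`, so the velocity is radial and `F
/ √s` is constant in time. A flow surviving at time `T` would pass through the origin there, which
is excluded. -/

open scoped RealInnerProductSpace

namespace KahlerMCF

/-! ### Rotationally symmetric Kähler metrics: derivatives, Christoffel symbols, radial normals. -/

section RadialMetric

variable {E : Type*} [NormedAddCommGroup E] [InnerProductSpace ℝ E]

/-- The Hermitian form `α ⟪u, v⟫ + β (⟪z, u⟫ ⟪z, v⟫ + ⟪J z, u⟫ ⟪J z, v⟫)`. -/
def radialForm (J : E →L[ℝ] E) (α β : ℝ) (z u v : E) : ℝ :=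
  α * ⟪u, v⟫ + β * (⟪z, u⟫ * ⟪z, v⟫ + ⟪J z, u⟫ * ⟪J z, v⟫)

/-- `G` is a rotationally symmetric Kähler metric on `E \ {0}` with respect to the complex
structure `J`: `a` is the first derivative of the potential as a function of `‖z‖ ^ 2`, `b` and
`b'` are its second and third derivatives. -/
structure IsRadialKahler (J : E →L[ℝ] E) (a b b' : ℝ → ℝ) (G : E → E → E → ℝ) : Prop where
  skew : ∀ x y, ⟪J x, y⟫ = -⟪x, J y⟫
  isometry : ∀ x y, ⟪J x, J y⟫ = ⟪x, y⟫
  deriv_a : ∀ s, 0 < s → HasDerivAt a (b s) s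
  deriv_b : ∀ s, 0 < s → HasDerivAt b (b' s) s
  a_pos : ∀ s, 0 < s → 0 < a s
  radial_pos : ∀ s, 0 < s → 0 < a s + s * b s
  eq_form : ∀ z, z ≠ 0 → ∀ u v, G z u v = radialForm J (a (‖z‖ ^ 2)) (b (‖z‖ ^ 2)) z u v

namespace IsRadialKahler

variable {J : E →L[ℝ] E} {a b b' : ℝ → ℝ} {G : E → E → E → ℝ}

theorem inner_J_self (h : IsRadialKahler J a b b' G) (x : E) : ⟪J x, x⟫ = 0 := by
  have := h.skew x x
  rw [real_inner_comm (J x) x] at this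
  linarith

theorem differentiableAt (h : IsRadialKahler J a b b' G) {z : E} (hz : z ≠ 0) (u v : E) :
    DifferentiableAt ℝ (fun q => G q u v) z := by
  have hs : 0 < ‖z‖ ^ 2 := by positivity
  have hn : DifferentiableAt ℝ (fun q : E => ‖q‖ ^ 2) z := differentiableAt_id.norm_sq ℝ
  have ha : DifferentiableAt ℝ (fun q : E => a (‖q‖ ^ 2)) z :=
    (h.deriv_a _ hs).differentiableAt.comp z hn
  have hb : DifferentiableAt ℝ (fun q : E => b (‖q‖ ^ 2)) z :=
    (h.deriv_b _ hs).differentiableAt.comp z hn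
  have : (fun q => G q u v) =ᶠ[𝓝 z]
      fun q => radialForm J (a (‖q‖ ^ 2)) (b (‖q‖ ^ 2)) q u v := by
    filter_upwards [isOpen_ne.mem_nhds hz] with q hq using h.eq_form q hq u v
  refine DifferentiableAt.congr_of_eventuallyEq ?_ this
  have hJ : DifferentiableAt ℝ (fun q : E => J q) z := J.differentiableAt
  have hi : ∀ y : E, DifferentiableAt ℝ (fun q : E => ⟪q, y⟫) z := fun y =>
    differentiableAt_id.inner ℝ (differentiableAt_const y)
  have hJi : ∀ y : E, DifferentiableAt ℝ (fun q : E => ⟪J q, y⟫) z := fun y =>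
    hJ.inner ℝ (differentiableAt_const y)
  exact (ha.mul_const _).add (hb.mul (((hi u).mul (hi v)).add ((hJi u).mul (hJi v))))

/-- The derivative of the metric along a curve, applied to vector fields along the curve. -/
theorem hasDerivAt_comp (h : IsRadialKahler J a b b' G) {γ n V : ℝ → E} {γ' n' V' : E} {t : ℝ}
    (hγ : HasDerivAt γ γ' t) (hn : HasDerivAt n n' t) (hV : HasDerivAt V V' t) (h0 : γ t ≠ 0) :
    HasDerivAt (fun s => G (γ s) (n s) (V s))
      (b (‖γ t‖ ^ 2) * (2 * ⟪γ t, γ'⟫) * ⟪n t, V t⟫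
        + a (‖γ t‖ ^ 2) * (⟪n t, V'⟫ + ⟪n', V t⟫)
        + b' (‖γ t‖ ^ 2) * (2 * ⟪γ t, γ'⟫)
          * (⟪γ t, n t⟫ * ⟪γ t, V t⟫ + ⟪J (γ t), n t⟫ * ⟪J (γ t), V t⟫)
        + b (‖γ t‖ ^ 2) * ((⟪γ t, n'⟫ + ⟪γ', n t⟫) * ⟪γ t, V t⟫
          + ⟪γ t, n t⟫ * (⟪γ t, V'⟫ + ⟪γ', V t⟫)
          + (⟪J (γ t), n'⟫ + ⟪J γ', n t⟫) * ⟪J (γ t), V t⟫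
          + ⟪J (γ t), n t⟫ * (⟪J (γ t), V'⟫ + ⟪J γ', V t⟫))) t := by
  have hs : 0 < ‖γ t‖ ^ 2 := by positivity
  have hS : HasDerivAt (fun s => ‖γ s‖ ^ 2) (2 * ⟪γ t, γ'⟫) t := hγ.norm_sq
  have hJ : HasDerivAt (fun s => J (γ s)) (J γ') t := J.hasFDerivAt.comp_hasDerivAt t hγ
  have hA : HasDerivAt (fun s => a (‖γ s‖ ^ 2)) _ t := (h.deriv_a _ hs).comp t hS
  have hB : HasDerivAt (fun s => b (‖γ s‖ ^ 2)) _ t := (h.deriv_b _ hs).comp t hS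
  have key := (hA.mul (hn.inner ℝ hV)).add
    (hB.mul (((hγ.inner ℝ hn).mul (hγ.inner ℝ hV)).add ((hJ.inner ℝ hn).mul (hJ.inner ℝ hV))))
  have heq : (fun s => G (γ s) (n s) (V s)) =ᶠ[𝓝 t] fun s =>
      radialForm J (a (‖γ s‖ ^ 2)) (b (‖γ s‖ ^ 2)) (γ s) (n s) (V s) := by
    filter_upwards [hγ.continuousAt.eventually_ne h0] with s hs using h.eq_form _ hs _ _
  refine (key.congr_of_eventuallyEq (heq.trans ?_)).congr_deriv ?_
  · exact Eventually.of_forall fun s => rfl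
  · simp only [Pi.add_apply, Pi.mul_apply]
    ring

/-- This is the curve formula specialised to the line `z + t • w` with constant fields. -/
theorem fderiv_apply (h : IsRadialKahler J a b b' G) {z : E} (hz : z ≠ 0) (u v w : E) :
    fderiv ℝ (fun q => G q u v) z w =
      b (‖z‖ ^ 2) * (2 * ⟪z, w⟫) * ⟪u, v⟫
        + b' (‖z‖ ^ 2) * (2 * ⟪z, w⟫) * (⟪z, u⟫ * ⟪z, v⟫ + ⟪J z, u⟫ * ⟪J z, v⟫)
        + b (‖z‖ ^ 2) * (⟪w, u⟫ * ⟪z, v⟫ + ⟪z, u⟫ * ⟪w, v⟫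
          + ⟪J w, u⟫ * ⟪J z, v⟫ + ⟪J z, u⟫ * ⟪J w, v⟫) := by
  have hγ : HasDerivAt (fun t : ℝ => z + t • w) w 0 := by
    simpa using ((hasDerivAt_id (0 : ℝ)).smul_const w).const_add z
  have hz' : z + (0 : ℝ) • w ≠ 0 := by simpa using hz
  have h1 := h.hasDerivAt_comp hγ (hasDerivAt_const (0 : ℝ) u) (hasDerivAt_const (0 : ℝ) v) hz'
  have h2 : HasFDerivAt (fun q => G q u v) (fderiv ℝ (fun q => G q u v) z) (z + (0 : ℝ) • w) := by
    simpa using (h.differentiableAt hz u v).hasFDerivAt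
  have h3 : HasDerivAt (fun t : ℝ => G (z + t • w) u v) (fderiv ℝ (fun q => G q u v) z w) 0 :=
    HasFDerivAt.comp_hasDerivAt (l := fun q => G q u v) (0 : ℝ) h2 hγ
  rw [h3.unique h1]
  simp only [zero_smul, add_zero, inner_zero_left, inner_zero_right, zero_add, mul_zero]

/-- The Christoffel symbol with one radial argument and two tangential ones. -/
theorem christoffel_radial (h : IsRadialKahler J a b b' G) {z : E} (hz : z ≠ 0) {U V : E} (c : ℝ)
    (hU : ⟪z, U⟫ = 0) (hV : ⟪z, V⟫ = 0) :
    christoffel G z U (c • z) V = c * (b (‖z‖ ^ 2) * (‖z‖ ^ 2 * ⟪U, V⟫ + ⟪J z, U⟫ * ⟪J z, V⟫)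
      + b' (‖z‖ ^ 2) * (‖z‖ ^ 2 * (⟪J z, U⟫ * ⟪J z, V⟫))) := by
  have hzz : ⟪z, z⟫ = ‖z‖ ^ 2 := real_inner_self_eq_norm_sq z
  have hJz := h.inner_J_self z
  have hJU : ⟪J U, z⟫ = -⟪J z, U⟫ := by rw [h.skew, real_inner_comm]
  have hJV : ⟪J V, z⟫ = -⟪J z, V⟫ := by rw [h.skew, real_inner_comm]
  have hUz : ⟪U, z⟫ = 0 := by rw [real_inner_comm, hU]
  have hVz : ⟪V, z⟫ = 0 := by rw [real_inner_comm, hV]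
  have hVU : ⟪V, U⟫ = ⟪U, V⟫ := real_inner_comm _ _
  simp only [christoffel, h.fderiv_apply hz, inner_smul_right, inner_smul_left, map_smul, hzz, hJz,
    hJU, hJV, hUz, hVz, hU, hV, hVU, RCLike.conj_to_real]
  ring

/-- If `b ≥ 0` the term in `a` suffices. If `b < 0`, Cauchy–Schwarz for `⟪J z, U⟫` leaves at least
`(a + s b) ‖U‖ ^ 2`. -/
theorem form_self_pos (h : IsRadialKahler J a b b' G) {z U : E} (hz : z ≠ 0) (hzU : ⟪z, U⟫ = 0)
    (hU : U ≠ 0) : 0 < G z U U := by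
  have hs : 0 < ‖z‖ ^ 2 := by positivity
  have hU2 : 0 < ‖U‖ ^ 2 := by positivity
  have ha := h.a_pos _ hs
  have hr := h.radial_pos _ hs
  have hJn : ‖J z‖ ^ 2 = ‖z‖ ^ 2 := by
    rw [← real_inner_self_eq_norm_sq, h.isometry, real_inner_self_eq_norm_sq]
  have hcs : ⟪J z, U⟫ ^ 2 ≤ ‖z‖ ^ 2 * ‖U‖ ^ 2 := by
    rw [← hJn, ← mul_pow]
    exact sq_le_sq.mpr (by
      rw [abs_of_nonneg (by positivity : 0 ≤ ‖J z‖ * ‖U‖)]; exact abs_real_inner_le_norm _ _)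
  rw [h.eq_form z hz, radialForm, hzU, real_inner_self_eq_norm_sq]
  rcases le_or_gt 0 (b (‖z‖ ^ 2)) with hb | hb
  · have : 0 ≤ b (‖z‖ ^ 2) * (⟪J z, U⟫ * ⟪J z, U⟫) := by
      rw [← sq]; positivity
    nlinarith [mul_pos ha hU2]
  · nlinarith [mul_pos hr hU2]

/-- A vector which is orthogonal to `zᗮ` with respect to the metric is radial. -/
theorem exists_smul_of_orthogonal (h : IsRadialKahler J a b b' G) {z ν : E} (hz : z ≠ 0)
    (hν : ∀ U, ⟪z, U⟫ = 0 → G z ν U = 0) (h1 : G z ν ν = 1) :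
    ∃ c : ℝ, ν = c • z ∧
      c ^ 2 * ((a (‖z‖ ^ 2) + ‖z‖ ^ 2 * b (‖z‖ ^ 2)) * ‖z‖ ^ 2) = 1 := by
  have hs : 0 < ‖z‖ ^ 2 := by positivity
  have ha := h.a_pos _ hs
  have hr := h.radial_pos _ hs
  have hzz : ⟪z, z⟫ = ‖z‖ ^ 2 := real_inner_self_eq_norm_sq z
  have hzJ : ⟪z, J z⟫ = 0 := by rw [real_inner_comm, h.inner_J_self]
  -- Testing against `J z` gives `(a + s b) ⟪J z, ν⟫ = 0`. Testing afterwards against the tangential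
  -- part `ν - c • z` itself shows that this part has norm zero.
  have hβ : ⟪J z, ν⟫ = 0 := by
    have := hν (J z) hzJ
    rw [h.eq_form z hz, radialForm, hzJ, h.isometry, hzz, real_inner_comm] at this
    have : (a (‖z‖ ^ 2) + ‖z‖ ^ 2 * b (‖z‖ ^ 2)) * ⟪J z, ν⟫ = 0 := by linarith
    exact (mul_eq_zero.mp this).resolve_left hr.ne'
  set c := ⟪z, ν⟫ / ‖z‖ ^ 2 with hc
  have hcz : c * ‖z‖ ^ 2 = ⟪z, ν⟫ := by rw [hc]; field_simp
  have hperp : ⟪z, ν - c • z⟫ = 0 := by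
    rw [inner_sub_right, inner_smul_right, hzz, hcz, sub_self]
  have hνc : ν = c • z := by
    have := hν _ hperp
    rw [h.eq_form z hz, radialForm, hperp, hβ] at this
    have h2 : ⟪ν, ν - c • z⟫ = 0 := by
      have : a (‖z‖ ^ 2) * ⟪ν, ν - c • z⟫ = 0 := by linarith
      exact (mul_eq_zero.mp this).resolve_left ha.ne'
    have h3 : ⟪ν - c • z, ν - c • z⟫ = 0 := by
      rw [inner_sub_left, h2, inner_smul_left, hperp]; simp
    exact sub_eq_zero.mp (inner_self_eq_zero.mp h3)
  refine ⟨c, hνc, ?_⟩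
  rw [h.eq_form z hz, radialForm, hβ] at h1
  rw [hνc] at h1
  simp only [inner_smul_left, inner_smul_right, hzz, RCLike.conj_to_real] at h1
  linear_combination h1

/-- Second fundamental form, computed in a chart at a critical point of `‖f‖ ^ 2`. -/
theorem second_fundamental_form_chart (h : IsRadialKahler J a b b' G)
    {W : Type*} [NormedAddCommGroup W] [NormedSpace ℝ W] {f n : W → E} {x : W}
    (hf : ContDiffAt ℝ 2 f x) (hn : DifferentiableAt ℝ n x) (hz : f x ≠ 0)
    (hcrit : ∀ X, ⟪f x, fderiv ℝ f x X⟫ = 0)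
    (horth : ∀ᶠ y in 𝓝 x, ∀ Y, G (f y) (n y) (fderiv ℝ f y Y) = 0)
    {c : ℝ} (hc : n x = c • f x) (X Y : W) :
    -(G (f x) (fderiv ℝ n x X) (fderiv ℝ f x Y)
      + christoffel G (f x) (fderiv ℝ f x X) (n x) (fderiv ℝ f x Y)) =
    c * ((a (‖f x‖ ^ 2) + ‖f x‖ ^ 2 * b (‖f x‖ ^ 2)) * ⟪f x, fderiv ℝ (fderiv ℝ f) x X Y⟫
      - (2 * b (‖f x‖ ^ 2) + ‖f x‖ ^ 2 * b' (‖f x‖ ^ 2))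
        * (⟪J (f x), fderiv ℝ f x X⟫ * ⟪J (f x), fderiv ℝ f x Y⟫)) := by
  have hγ : HasDerivAt (fun t : ℝ => x + t • X) X 0 := by
    simpa using ((hasDerivAt_id (0 : ℝ)).smul_const X).const_add x
  have e0 : x + (0 : ℝ) • X = x := by simp
  have hf1 : HasFDerivAt f (fderiv ℝ f x) (x + (0 : ℝ) • X) := by
    rw [e0]; exact (hf.differentiableAt (by norm_num)).hasFDerivAt
  have hn1 : HasFDerivAt n (fderiv ℝ n x) (x + (0 : ℝ) • X) := by
    rw [e0]; exact hn.hasFDerivAt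
  have hf2 : HasFDerivAt (fderiv ℝ f) (fderiv ℝ (fderiv ℝ f) x) (x + (0 : ℝ) • X) := by
    rw [e0]
    exact ((hf.fderiv_right (m := 1) (by norm_num)).differentiableAt (by norm_num)).hasFDerivAt
  have c1 := hf1.comp_hasDerivAt (0 : ℝ) hγ
  have c2 := hn1.comp_hasDerivAt (0 : ℝ) hγ
  have c3 : HasDerivAt (fun t : ℝ => fderiv ℝ f (x + t • X) Y)
      (fderiv ℝ (fderiv ℝ f) x X Y) 0 := by
    have c4 : HasDerivAt (fun t : ℝ => fderiv ℝ f (x + t • X)) (fderiv ℝ (fderiv ℝ f) x X) 0 :=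
      hf2.comp_hasDerivAt (0 : ℝ) hγ
    exact ((ContinuousLinearMap.apply ℝ E Y).hasFDerivAt).comp_hasDerivAt (0 : ℝ) c4
  have key := h.hasDerivAt_comp c1 c2 c3 (by simpa using hz)
  -- Weingarten's relation: differentiating `G (n, df Y) = 0` along the line trades the unknown
  -- derivative of `n` for the second derivative of `f`.
  have hzero : (fun t : ℝ => G ((f ∘ fun t : ℝ => x + t • X) t) ((n ∘ fun t : ℝ => x + t • X) t)
      (fderiv ℝ f (x + t • X) Y)) =ᶠ[𝓝 0] fun _ => 0 := by
    have : Tendsto (fun t : ℝ => x + t • X) (𝓝 0) (𝓝 x) := by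
      simpa using hγ.continuousAt.tendsto
    filter_upwards [this.eventually horth] with t ht using ht Y
  have key2 := key.unique ((hasDerivAt_const (0 : ℝ) (0 : ℝ)).congr_of_eventuallyEq hzero)
  have hzz : ⟪f x, f x⟫ = ‖f x‖ ^ 2 := real_inner_self_eq_norm_sq _
  have hJz := h.inner_J_self (f x)
  have hJU : ⟪J (fderiv ℝ f x X), f x⟫ = -⟪J (f x), fderiv ℝ f x X⟫ := by
    rw [h.skew, real_inner_comm]
  simp only [Function.comp_apply, e0, hc, inner_smul_left, inner_smul_right, hcrit, hzz, hJz, hJU,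
    RCLike.conj_to_real] at key2
  rw [hc, h.christoffel_radial hz c (hcrit X) (hcrit Y), h.eq_form _ hz, radialForm, hcrit]
  linear_combination -key2

end IsRadialKahler

end RadialMetric

/-! ### Differentials on the manifold versus derivatives in a chart. -/

section Chart

variable {E : Type*} [NormedAddCommGroup E] [NormedSpace ℝ E] {d : ℕ}
  {N : Type*} [TopologicalSpace N] [ChartedSpace (EuclideanSpace ℝ (Fin d)) N]

theorem diff_eq_fderiv {F : N → E} {p : N} (hF : MDifferentiableAt (𝓡 d) 𝓘(ℝ, E) F p) :
    diff d F p = fderiv ℝ (F ∘ (chartAt (EuclideanSpace ℝ (Fin d)) p).symm)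
      (chartAt (EuclideanSpace ℝ (Fin d)) p p) := by
  ext X
  rw [diff, hF.mfderiv]
  simp only [writtenInExtChartAt, extChartAt, mfld_simps, fderivWithin_univ]
  rfl

theorem contDiffAt_comp_chart_symm [IsManifold (𝓡 d) ∞ N] {F : N → E}
    (hF : ContMDiff (𝓡 d) 𝓘(ℝ, E) ∞ F) (p : N) {y : EuclideanSpace ℝ (Fin d)}
    (hy : y ∈ (chartAt (EuclideanSpace ℝ (Fin d)) p).target) :
    ContDiffAt ℝ ∞ (F ∘ (chartAt (EuclideanSpace ℝ (Fin d)) p).symm) y := by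
  have h1 : ContMDiffAt (𝓡 d) (𝓡 d) ∞ (chartAt (EuclideanSpace ℝ (Fin d)) p).symm y :=
    (contMDiffOn_chart_symm (I := 𝓡 d) (n := ∞) (x := p)).contMDiffAt
      ((chartAt (EuclideanSpace ℝ (Fin d)) p).open_target.mem_nhds hy)
  exact (hF.contMDiffAt.comp y h1).contDiffAt

/-- `diff` at a nearby point is read in that point's own preferred chart. This lemma carries the
normality condition over to the single chart at `p`, where it can be differentiated. -/
theorem exists_diff_eq_fderiv_comp_chart_symm [IsManifold (𝓡 d) ∞ N] {F : N → E}
    (hF : ContMDiff (𝓡 d) 𝓘(ℝ, E) ∞ F) (p : N) {y : EuclideanSpace ℝ (Fin d)}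
    (hy : y ∈ (chartAt (EuclideanSpace ℝ (Fin d)) p).target) (Y : EuclideanSpace ℝ (Fin d)) :
    ∃ X, fderiv ℝ (F ∘ (chartAt (EuclideanSpace ℝ (Fin d)) p).symm) y Y =
      diff d F ((chartAt (EuclideanSpace ℝ (Fin d)) p).symm y) X := by
  have h1 : MDifferentiableAt (𝓡 d) (𝓡 d) (chartAt (EuclideanSpace ℝ (Fin d)) p).symm y :=
    ((contMDiffOn_chart_symm (I := 𝓡 d) (n := ∞) (x := p)).contMDiffAt
      ((chartAt (EuclideanSpace ℝ (Fin d)) p).open_target.mem_nhds hy)).mdifferentiableAt (by simp)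
  have h2 : MDifferentiableAt (𝓡 d) 𝓘(ℝ, E) F
      ((chartAt (EuclideanSpace ℝ (Fin d)) p).symm y) := hF.mdifferentiableAt (by simp)
  refine ⟨mfderiv (𝓡 d) (𝓡 d) (chartAt (EuclideanSpace ℝ (Fin d)) p).symm y Y, ?_⟩
  rw [← mfderiv_eq_fderiv, mfderiv_comp y h2 h1]
  rfl

end Chart

/-! ### Traces and rank one perturbations of matrices. -/

section LinearAlgebra

open Matrix

variable {n : Type*} [Fintype n]

theorem vecMulVec_mul_vecMulVec_eq_smul {β w : n → ℝ} {s : ℝ} (hs : β ⬝ᵥ w = s) (v : n → ℝ) :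
    vecMulVec v β * vecMulVec w β = s • vecMulVec v β := by
  rw [vecMulVec_mul_vecMulVec, hs]
  ext i j
  simp only [vecMulVec_apply, Matrix.smul_apply, smul_eq_mul, Pi.smul_apply]
  ring

variable [DecidableEq n]

-- Factor `g⁻¹ = Bᴴ * B`. By cyclicity the trace is the sum of the values of the quadratic form of
-- `H` on the rows of `B`.
open scoped MatrixOrder in
theorem trace_inv_mul_nonpos {g H : Matrix n n ℝ} (hg : g.PosDef)
    (hH : ∀ x : n → ℝ, x ⬝ᵥ (H *ᵥ x) ≤ 0) : (g⁻¹ * H).trace ≤ 0 := by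
  obtain ⟨B, hB⟩ := CStarAlgebra.nonneg_iff_eq_star_mul_self.mp hg.inv.posSemidef.nonneg
  rw [hB, Matrix.star_eq_conjTranspose, Matrix.mul_assoc, Matrix.trace_mul_comm, Matrix.trace]
  refine Finset.sum_nonpos fun i _ => ?_
  have := hH (B i)
  rw [dotProduct_mulVec] at this
  exact this

variable {P : Matrix n n ℝ} {β w : n → ℝ} {s : ℝ}

/-- Inversion of a rank one perturbation of `P` relative to another one. -/
theorem inv_rank_one_mul (hw : P *ᵥ w = β) (hs : β ⬝ᵥ w = s) {a b l l' α κ : ℝ}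
    (hα : a * α = l) (hκ : a * κ + b * α + b * s * κ = l')
    (hg : IsUnit (a • P + b • vecMulVec β β).det) :
    (a • P + b • vecMulVec β β)⁻¹ * (l • P + l' • vecMulVec β β) =
      α • (1 : Matrix n n ℝ) + κ • vecMulVec w β := by
  have hPN : P * vecMulVec w β = vecMulVec β β := by rw [mul_vecMulVec, hw]
  have : (a • P + b • vecMulVec β β) * (α • (1 : Matrix n n ℝ) + κ • vecMulVec w β) =
      l • P + l' • vecMulVec β β := by
    rw [← hα, ← hκ]
    simp only [add_mul, mul_add, Matrix.smul_mul, Matrix.mul_smul, hPN,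
      vecMulVec_mul_vecMulVec_eq_smul hs, Matrix.mul_one]
    module
  rw [← this, Matrix.nonsing_inv_mul_cancel_left _ _ hg]

theorem trace_rank_one (hs : β ⬝ᵥ w = s) (α κ : ℝ) :
    (α • (1 : Matrix n n ℝ) + κ • vecMulVec w β).trace = α * Fintype.card n + κ * s := by
  simp [Matrix.trace_vecMulVec, dotProduct_comm w β, hs]

/-- The matrix acts as `α` on the kernel of `β` and sends `w` to `(α + κ s) w`, which explains the
two squares. -/
theorem trace_rank_one_mul_self (hs : β ⬝ᵥ w = s) (α κ : ℝ) :
    ((α • (1 : Matrix n n ℝ) + κ • vecMulVec w β) *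
      (α • (1 : Matrix n n ℝ) + κ • vecMulVec w β)).trace =
      α ^ 2 * (Fintype.card n - 1) + (α + κ * s) ^ 2 := by
  have : (α • (1 : Matrix n n ℝ) + κ • vecMulVec w β) *
      (α • (1 : Matrix n n ℝ) + κ • vecMulVec w β) =
      (α ^ 2) • (1 : Matrix n n ℝ) + (2 * α * κ + κ ^ 2 * s) • vecMulVec w β := by
    simp only [add_mul, mul_add, Matrix.smul_mul, Matrix.mul_smul, vecMulVec_mul_vecMulVec_eq_smul hs,
      Matrix.mul_one, Matrix.one_mul]
    module
  rw [this, trace_rank_one hs]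
  ring

end LinearAlgebra

/-! ### First and second order conditions at extrema of `‖f‖ ^ 2`. -/

section Hessian

variable {E : Type*} [NormedAddCommGroup E] [InnerProductSpace ℝ E]
  {W : Type*} [NormedAddCommGroup W] [NormedSpace ℝ W] {f : W → E} {x : W}

/-- The function differentiated is half the derivative of `‖f‖ ^ 2` in the direction `Y`, so the
result is half its Hessian. -/
theorem hasDerivAt_inner_fderiv_line (hf : ContDiffAt ℝ 2 f x) (X Y : W) :
    HasDerivAt (fun t : ℝ => ⟪f (x + t • X), fderiv ℝ f (x + t • X) Y⟫)
      (⟪fderiv ℝ f x X, fderiv ℝ f x Y⟫ + ⟪f x, fderiv ℝ (fderiv ℝ f) x X Y⟫) 0 := by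
  have hγ : HasDerivAt (fun t : ℝ => x + t • X) X 0 := by
    simpa using ((hasDerivAt_id (0 : ℝ)).smul_const X).const_add x
  have e0 : x + (0 : ℝ) • X = x := by simp
  have hf1 : HasFDerivAt f (fderiv ℝ f x) (x + (0 : ℝ) • X) := by
    rw [e0]; exact (hf.differentiableAt (by norm_num)).hasFDerivAt
  have hf2 : HasFDerivAt (fderiv ℝ f) (fderiv ℝ (fderiv ℝ f) x) (x + (0 : ℝ) • X) := by
    rw [e0]
    exact ((hf.fderiv_right (m := 1) (by norm_num)).differentiableAt (by norm_num)).hasFDerivAt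
  have c1 : HasDerivAt (fun t : ℝ => f (x + t • X)) (fderiv ℝ f x X) 0 :=
    hf1.comp_hasDerivAt (0 : ℝ) hγ
  have c4 : HasDerivAt (fun t : ℝ => fderiv ℝ f (x + t • X)) (fderiv ℝ (fderiv ℝ f) x X) 0 :=
    hf2.comp_hasDerivAt (0 : ℝ) hγ
  have c3 : HasDerivAt (fun t : ℝ => fderiv ℝ f (x + t • X) Y)
      (fderiv ℝ (fderiv ℝ f) x X Y) 0 :=
    ((ContinuousLinearMap.apply ℝ E Y).hasFDerivAt).comp_hasDerivAt (0 : ℝ) c4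
  have := c1.inner ℝ c3
  simp only [e0] at this
  rwa [add_comm] at this

theorem eventually_hasDerivAt_norm_sq_line (hf : ContDiffAt ℝ 2 f x) (X : W) :
    ∀ᶠ t : ℝ in 𝓝 0, HasDerivAt (fun t : ℝ => ‖f (x + t • X)‖ ^ 2)
      (2 * ⟪f (x + t • X), fderiv ℝ f (x + t • X) X⟫) t := by
  have hev : ∀ᶠ y in 𝓝 x, DifferentiableAt ℝ f y :=
    (hf.eventually (by simp)).mono fun y hy => hy.differentiableAt (by norm_num)
  have ht : Tendsto (fun t : ℝ => x + t • X) (𝓝 0) (𝓝 x) := by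
    have : Continuous (fun t : ℝ => x + t • X) := by fun_prop
    simpa using this.tendsto 0
  filter_upwards [ht.eventually hev] with t h
  have hγ : HasDerivAt (fun t : ℝ => x + t • X) X t := by
    simpa using ((hasDerivAt_id t).smul_const X).const_add x
  exact (h.hasFDerivAt.comp_hasDerivAt t hγ).norm_sq

/-- The second order necessary condition for a local maximum of `‖f‖ ^ 2`. -/
theorem hessian_norm_sq_nonpos (hf : ContDiffAt ℝ 2 f x)
    (hmax : IsLocalMax (fun y => ‖f y‖ ^ 2) x) (X : W) :
    ⟪fderiv ℝ f x X, fderiv ℝ f x X⟫ + ⟪f x, fderiv ℝ (fderiv ℝ f) x X X⟫ ≤ 0 := by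
  by_contra! hpos
  set q : ℝ → ℝ := fun t => ‖f (x + t • X)‖ ^ 2
  have hev := eventually_hasDerivAt_norm_sq_line hf X
  have hder : deriv q =ᶠ[𝓝 0] fun t => 2 * ⟪f (x + t • X), fderiv ℝ f (x + t • X) X⟫ :=
    hev.mono fun t ht => ht.deriv
  have h2 : deriv (deriv q) 0 =
      2 * (⟪fderiv ℝ f x X, fderiv ℝ f x X⟫ + ⟪f x, fderiv ℝ (fderiv ℝ f) x X X⟫) := by
    rw [hder.deriv_eq]
    exact ((hasDerivAt_inner_fderiv_line hf X X).const_mul 2).deriv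
  have ht : Tendsto (fun t : ℝ => x + t • X) (𝓝 0) (𝓝 x) := by
    have : Continuous (fun t : ℝ => x + t • X) := by fun_prop
    simpa using this.tendsto 0
  have hqmax : IsLocalMax q 0 := by
    filter_upwards [ht.eventually hmax] with t ht
    simpa [q] using ht
  -- A positive second derivative would make `0` a local minimum as well as a maximum. Then `q`
  -- would be locally constant and its second derivative zero.
  have hqmin : IsLocalMin q 0 :=
    isLocalMin_of_deriv_deriv_pos (by rw [h2]; linarith) hqmax.deriv_eq_zero
      hev.self_of_nhds.continuousAt
  have hconst : q =ᶠ[𝓝 0] fun _ => q 0 := by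
    filter_upwards [hqmax, hqmin] with t h1 h2 using le_antisymm h1 h2
  have : deriv (deriv q) 0 = 0 := by
    rw [hconst.deriv.deriv_eq]
    simp
  linarith

/-- The second order necessary condition for a local minimum of `‖f‖ ^ 2`. -/
theorem hessian_norm_sq_nonneg (hf : ContDiffAt ℝ 2 f x)
    (hmin : IsLocalMin (fun y => ‖f y‖ ^ 2) x) (X : W) :
    0 ≤ ⟪fderiv ℝ f x X, fderiv ℝ f x X⟫ + ⟪f x, fderiv ℝ (fderiv ℝ f) x X X⟫ := by
  by_contra! hneg
  set q : ℝ → ℝ := fun t => ‖f (x + t • X)‖ ^ 2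
  have hev := eventually_hasDerivAt_norm_sq_line hf X
  have hder : deriv q =ᶠ[𝓝 0] fun t => 2 * ⟪f (x + t • X), fderiv ℝ f (x + t • X) X⟫ :=
    hev.mono fun t ht => ht.deriv
  have h2 : deriv (deriv q) 0 =
      2 * (⟪fderiv ℝ f x X, fderiv ℝ f x X⟫ + ⟪f x, fderiv ℝ (fderiv ℝ f) x X X⟫) := by
    rw [hder.deriv_eq]
    exact ((hasDerivAt_inner_fderiv_line hf X X).const_mul 2).deriv
  have ht : Tendsto (fun t : ℝ => x + t • X) (𝓝 0) (𝓝 x) := by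
    have : Continuous (fun t : ℝ => x + t • X) := by fun_prop
    simpa using this.tendsto 0
  have hqmin : IsLocalMin q 0 := by
    filter_upwards [ht.eventually hmin] with t ht
    simpa [q] using ht
  have hqmax : IsLocalMax q 0 :=
    isLocalMax_of_deriv_deriv_neg (by rw [h2]; linarith) hqmin.deriv_eq_zero
      hev.self_of_nhds.continuousAt
  have hconst : q =ᶠ[𝓝 0] fun _ => q 0 := by
    filter_upwards [hqmax, hqmin] with t h1 h2 using le_antisymm h1 h2
  have : deriv (deriv q) 0 = 0 := by
    rw [hconst.deriv.deriv_eq]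
    simp
  linarith

theorem inner_fderiv_eq_zero_of_isLocalExtr (hf : DifferentiableAt ℝ f x)
    (hext : IsLocalExtr (fun y => ‖f y‖ ^ 2) x) (X : W) : ⟪f x, fderiv ℝ f x X⟫ = 0 := by
  have h1 := congrArg (fun L => L X) (hext.hasFDerivAt_eq_zero hf.hasFDerivAt.norm_sq)
  simpa using h1

/-- Every nearby point is critical, so the first derivative vanishes along a whole line. Doing this
for a pair `X`, `Y` gives the full bilinear form without polarisation. -/
theorem hessian_norm_sq_eq_zero (hf : ContDiffAt ℝ 2 f x)
    (hconst : ∀ᶠ y in 𝓝 x, ‖f y‖ ^ 2 = ‖f x‖ ^ 2) (X Y : W) :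
    ⟪fderiv ℝ f x X, fderiv ℝ f x Y⟫ + ⟪f x, fderiv ℝ (fderiv ℝ f) x X Y⟫ = 0 := by
  have hev : ∀ᶠ y in 𝓝 x, DifferentiableAt ℝ f y :=
    (hf.eventually (by simp)).mono fun y hy => hy.differentiableAt (by norm_num)
  have ht : Tendsto (fun t : ℝ => x + t • X) (𝓝 0) (𝓝 x) := by
    have : Continuous (fun t : ℝ => x + t • X) := by fun_prop
    simpa using this.tendsto 0
  refine (hasDerivAt_inner_fderiv_line hf X Y).unique
    ((hasDerivAt_const (0 : ℝ) (0 : ℝ)).congr_of_eventuallyEq ?_)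
  filter_upwards [ht.eventually (hev.and hconst.eventually_nhds)] with t ht
  refine inner_fderiv_eq_zero_of_isLocalExtr ht.1 (Or.inl ?_) Y
  have h0 := ht.2.self_of_nhds
  filter_upwards [ht.2] with y hy
  rw [hy, h0]

end Hessian

/-! ### The shape operator at a critical point of `‖F‖ ^ 2`. -/

section CriticalPoint

variable {E : Type*} [NormedAddCommGroup E] [InnerProductSpace ℝ E]
  {J : E →L[ℝ] E} {a b b' : ℝ → ℝ} {G : E → E → E → ℝ} {d : ℕ}
  {N : Type*} [TopologicalSpace N] [ChartedSpace (EuclideanSpace ℝ (Fin d)) N]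

/-- Half of the second derivative of `‖F‖ ^ 2` in the preferred chart at `p`. -/
noncomputable def halfHessian (d : ℕ) {N : Type*} [TopologicalSpace N]
    [ChartedSpace (EuclideanSpace ℝ (Fin d)) N] (F : N → E) (p : N)
    (X Y : EuclideanSpace ℝ (Fin d)) : ℝ :=
  ⟪diff d F p X, diff d F p Y⟫ +
    ⟪F p, fderiv ℝ (fderiv ℝ (F ∘ (chartAt (EuclideanSpace ℝ (Fin d)) p).symm))
      (chartAt (EuclideanSpace ℝ (Fin d)) p p) X Y⟫

/-- The rate at which `‖z‖ ^ 2 / 2` decreases along the flow of the spheres `‖z‖ ^ 2 = s`. -/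
noncomputable def radialSpeed (a b b' : ℝ → ℝ) (d : ℕ) (s : ℝ) : ℝ :=
  ((d - 1) * ((a s + s * b s) / a s) + 1 + s * (2 * b s + s * b' s) / (a s + s * b s))
    / (a s + s * b s)

/-- `|A|²` of the sphere `‖z‖ ^ 2 = s`. -/
noncomputable def sphereNormSqA (a b b' : ℝ → ℝ) (d : ℕ) (s : ℝ) : ℝ :=
  ((d - 1) * ((a s + s * b s) / a s) ^ 2
    + (1 + s * (2 * b s + s * b' s) / (a s + s * b s)) ^ 2) / ((a s + s * b s) * s)

theorem eventually_chart {P : N → Prop} {p : N} (h : ∀ᶠ q in 𝓝 p, P q) :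
    ∀ᶠ y in 𝓝 (chartAt (EuclideanSpace ℝ (Fin d)) p p),
      P ((chartAt (EuclideanSpace ℝ (Fin d)) p).symm y) := by
  have ht := (chartAt (EuclideanSpace ℝ (Fin d)) p).continuousAt_symm (mem_chart_target _ p)
  rw [ContinuousAt, (chartAt (EuclideanSpace ℝ (Fin d)) p).left_inv (mem_chart_source _ p)] at ht
  exact ht.eventually h

end CriticalPoint

namespace IsRadialKahler

open Matrix

variable {E : Type*} [NormedAddCommGroup E] [InnerProductSpace ℝ E]
  {J : E →L[ℝ] E} {a b b' : ℝ → ℝ} {G : E → E → E → ℝ} {d : ℕ}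
  {N : Type*} [TopologicalSpace N] [ChartedSpace (EuclideanSpace ℝ (Fin d)) N]

theorem dotProduct_mulVec_bilin
    (B : EuclideanSpace ℝ (Fin d) →ₗ[ℝ] EuclideanSpace ℝ (Fin d) →ₗ[ℝ] ℝ) (x : Fin d → ℝ) :
    x ⬝ᵥ ((Matrix.of fun i j => B (EuclideanSpace.single i 1) (EuclideanSpace.single j 1)) *ᵥ x) =
      B (WithLp.toLp 2 x) (WithLp.toLp 2 x) := by
  have hx : WithLp.toLp 2 x = ∑ i, x i • (EuclideanSpace.single i 1 : EuclideanSpace ℝ (Fin d)) := by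
    rw [← (EuclideanSpace.basisFun (Fin d) ℝ).sum_repr (WithLp.toLp 2 x)]
    simp
  simp only [hx, map_sum, map_smul, LinearMap.sum_apply, LinearMap.smul_apply, dotProduct, mulVec,
    Matrix.of_apply, smul_eq_mul, Finset.mul_sum]
  rw [Finset.sum_comm]
  exact Finset.sum_congr rfl fun i _ => Finset.sum_congr rfl fun j _ => by ring

/-- The range lies in `zᗮ`, and both have dimension `d`. -/
theorem exists_eq_of_inner_eq_zero (hd : Module.finrank ℝ E = d + 1)
    {L : EuclideanSpace ℝ (Fin d) →L[ℝ] E} (hinj : Function.Injective L) {z : E} (hz : z ≠ 0)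
    (hL : ∀ X, ⟪z, L X⟫ = 0) {U : E} (hU : ⟪z, U⟫ = 0) : ∃ X, L X = U := by
  have : FiniteDimensional ℝ E := Module.finite_of_finrank_eq_succ hd
  have hle : L.toLinearMap.range ≤ (ℝ ∙ z)ᗮ := by
    rintro _ ⟨X, rfl⟩
    exact Submodule.mem_orthogonal_singleton_iff_inner_right.mpr (hL X)
  have h1 : Module.finrank ℝ L.toLinearMap.range = d := by
    rw [LinearMap.finrank_range_of_inj hinj]; simp
  have h2 : Module.finrank ℝ (ℝ ∙ z)ᗮ = d := by
    have : Fact (Module.finrank ℝ E = d + 1) := ⟨hd⟩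
    exact Submodule.finrank_orthogonal_span_singleton hz
  have h3 := Submodule.eq_of_le_of_finrank_eq hle (h1.trans h2.symm)
  have hU' : U ∈ (ℝ ∙ z)ᗮ := Submodule.mem_orthogonal_singleton_iff_inner_right.mpr hU
  rw [← h3] at hU'
  exact hU'

/-- The shape operator at a critical point of `‖F‖ ^ 2`. -/
theorem shapeOperator_of_critical (h : IsRadialKahler J a b b' G) [IsManifold (𝓡 d) ∞ N]
    (hd : Module.finrank ℝ E = d + 1) {F ν : N → E} (hF : ContMDiff (𝓡 d) 𝓘(ℝ, E) ∞ F)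
    (hν : IsUnitNormal d G F ν) {p : N} (hinj : Function.Injective (diff d F p)) (h0 : F p ≠ 0)
    (hcrit : ∀ X, ⟪F p, diff d F p X⟫ = 0) {s l l' : ℝ} (hs : s = ‖F p‖ ^ 2)
    (hl : l = a s + s * b s) (hl' : l' = 2 * b s + s * b' s) :
    ∃ (c : ℝ) (β w : Fin d → ℝ), ν p = c • F p ∧ c ^ 2 * (l * s) = 1 ∧ β ⬝ᵥ w = s ∧
      (inducedMetric d G F p).PosDef ∧
      shapeOperator d G F ν p = c • (l • ((inducedMetric d G F p)⁻¹ *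
          Matrix.of fun i j => halfHessian d F p (EuclideanSpace.single i 1)
            (EuclideanSpace.single j 1))
        - ((l / a s) • (1 : Matrix (Fin d) (Fin d) ℝ)
          + ((l' - b s * (l / a s)) / l) • vecMulVec w β)) := by
  have hs0 : 0 < s := by rw [hs]; positivity
  have ha := h.a_pos _ hs0
  have hl0 : 0 < l := hl ▸ h.radial_pos _ hs0
  have hdF := diff_eq_fderiv (hF.mdifferentiableAt (x := p) (by simp))
  have hdν := diff_eq_fderiv (hν.smooth.mdifferentiableAt (x := p) (by simp))
  set φ := chartAt (EuclideanSpace ℝ (Fin d)) p with hφ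
  have hpt : φ p ∈ φ.target := mem_chart_target _ p
  have hps : φ.symm (φ p) = p := φ.left_inv (mem_chart_source _ p)
  set f := F ∘ φ.symm with hf
  set n := ν ∘ φ.symm with hn
  have hfp : f (φ p) = F p := by simp [hf, hps]
  have hnp : n (φ p) = ν p := by simp [hn, hps]
  have hfs : ContDiffAt ℝ 2 f (φ p) :=
    contDiffAt_infty.mp (contDiffAt_comp_chart_symm hF p hpt) 2
  have hns : DifferentiableAt ℝ n (φ p) :=
    (contDiffAt_comp_chart_symm hν.smooth p hpt).differentiableAt (by simp)
  -- Normality is needed on a whole neighbourhood, since it is about to be differentiated.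
  have horth : ∀ᶠ y in 𝓝 (φ p), ∀ Y, G (f y) (n y) (fderiv ℝ f y Y) = 0 := by
    filter_upwards [φ.open_target.mem_nhds hpt] with y hy Y
    obtain ⟨X, hX⟩ := exists_diff_eq_fderiv_comp_chart_symm hF p hy Y
    rw [hf, hX]
    exact hν.normal _ X
  set L := fderiv ℝ f (φ p) with hL
  have hLcrit : ∀ X, ⟪F p, L X⟫ = 0 := fun X => by rw [← hdF]; exact hcrit X
  have hLinj : Function.Injective L := by rw [← hdF]; exact hinj
  have hsurj : ∀ U, ⟪F p, U⟫ = 0 → ∃ X, L X = U := fun U hU =>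
    exists_eq_of_inner_eq_zero hd hLinj h0 hLcrit hU
  obtain ⟨c, hc, hc1⟩ := h.exists_smul_of_orthogonal (ν := ν p) h0 (fun U hU => by
    obtain ⟨X, rfl⟩ := hsurj U hU
    rw [← hdF]
    exact hν.normal p X) (hν.unit p)
  -- `J (F p)` is tangent because `J` is skew. Its preimage `w` is dual to `β`: with `P` the
  -- Euclidean Gram matrix, `P w = β` and `β ⬝ᵥ w = s`.
  obtain ⟨w, hw⟩ := hsurj (J (F p)) (by rw [real_inner_comm, h.inner_J_self])
  set e : Fin d → EuclideanSpace ℝ (Fin d) := fun i => EuclideanSpace.single i 1 with he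
  have hsum : ∀ x : Fin d → ℝ, L (WithLp.toLp 2 x) = ∑ i, x i • L (e i) := by
    intro x
    rw [← (EuclideanSpace.basisFun (Fin d) ℝ).sum_repr (WithLp.toLp 2 x)]
    simp [he]
  set β : Fin d → ℝ := fun i => ⟪J (F p), L (e i)⟫ with hβ
  set P : Matrix (Fin d) (Fin d) ℝ := Matrix.of fun i j => ⟪L (e i), L (e j)⟫ with hP
  have hwL : L (WithLp.toLp 2 w.ofLp) = J (F p) := hw
  have hPw : P *ᵥ w.ofLp = β := by
    ext i
    have : ⟪J (F p), L (e i)⟫ = ∑ j, w.ofLp j * ⟪L (e j), L (e i)⟫ := by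
      rw [← hwL, hsum, sum_inner]
      simp [inner_smul_left]
    rw [hβ]
    simp only [this, Matrix.mulVec, dotProduct, hP, Matrix.of_apply]
    exact Finset.sum_congr rfl fun j _ => by rw [real_inner_comm, mul_comm]
  have hβw : β ⬝ᵥ w.ofLp = s := by
    have : ⟪J (F p), J (F p)⟫ = ∑ j, w.ofLp j * ⟪J (F p), L (e j)⟫ := by
      nth_rewrite 2 [← hwL]
      rw [hsum, inner_sum]
      simp [inner_smul_right]
    rw [h.isometry, real_inner_self_eq_norm_sq, ← hs] at this
    rw [this, dotProduct]
    exact Finset.sum_congr rfl fun j _ => mul_comm _ _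
  have hg : inducedMetric d G F p = a s • P + b s • vecMulVec β β := by
    ext i j
    simp only [inducedMetric, Matrix.of_apply, hdF, h.eq_form _ h0, radialForm, ← hs, hLcrit,
      Matrix.add_apply, Matrix.smul_apply, vecMulVec_apply, smul_eq_mul, hP, hβ, he]
    ring
  have hgpos : (inducedMetric d G F p).PosDef := by
    refine Matrix.PosDef.of_dotProduct_mulVec_pos ?_ fun x hx => ?_
    · ext i j
      simp [hg, hP, vecMulVec_apply, real_inner_comm, mul_comm]
    · have hLx : L (WithLp.toLp 2 x) ≠ 0 := fun h0 => hx (by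
        have := hLinj (h0.trans (map_zero L).symm)
        simpa using this)
      have hpos := h.form_self_pos h0 (hLcrit _) hLx
      have hb : ⟪J (F p), L (WithLp.toLp 2 x)⟫ = β ⬝ᵥ x := by
        rw [hsum, inner_sum]
        simp [inner_smul_right, dotProduct, hβ, mul_comm]
      have hPx : ⟪L (WithLp.toLp 2 x), L (WithLp.toLp 2 x)⟫ = x ⬝ᵥ (P *ᵥ x) := by
        exact (dotProduct_mulVec_bilin (LinearMap.mk₂ ℝ (fun X Y => ⟪L X, L Y⟫)
          (by simp [inner_add_left]) (by simp [inner_smul_left])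
          (by simp [inner_add_right]) (by simp [inner_smul_right])) x).symm
      rw [h.eq_form _ h0, radialForm, hLcrit, hb, hPx, ← hs] at hpos
      rw [hg, star_trivial, add_mulVec, dotProduct_add, smul_mulVec, smul_mulVec, dotProduct_smul,
        dotProduct_smul, vecMulVec_mulVec]
      simp only [smul_eq_mul, dotProduct_smul, MulOpposite.smul_eq_mul_unop, MulOpposite.unop_op,
        dotProduct_comm x β]
      linarith
  have hsff : (Matrix.of fun i j => secondFundamentalForm d G F ν p (EuclideanSpace.single i 1)
        (EuclideanSpace.single j 1)) =
      c • (l • (Matrix.of fun i j => halfHessian d F p (EuclideanSpace.single i 1)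
            (EuclideanSpace.single j 1)) - (l • P + l' • vecMulVec β β)) := by
    ext i j
    have key := h.second_fundamental_form_chart hfs hns (by rw [hfp]; exact h0)
      (by rw [hfp]; exact hLcrit) horth (by rw [hfp, hnp]; exact hc) (e i) (e j)
    rw [hfp, hnp, ← hs] at key
    simp only [Matrix.of_apply, secondFundamentalForm, hdF, hdν, halfHessian, Matrix.sub_apply,
      Matrix.add_apply, Matrix.smul_apply, vecMulVec_apply, smul_eq_mul]
    refine key.trans ?_
    simp only [hP, hβ, he, Matrix.of_apply, hl, hl', ← hφ, ← hf, ← hL]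
    ring
  have hunit : IsUnit (inducedMetric d G F p).det := hgpos.isUnit.map Matrix.detMonoidHom
  refine ⟨c, β, w.ofLp, hc, ?_, hβw, hgpos, ?_⟩
  · rw [hl, hs]; exact hc1
  · rw [shapeOperator, hsff, Matrix.mul_smul, Matrix.mul_sub, Matrix.mul_smul]
    -- `α` solves `a α = l`. The equation for `κ` then reads `(a + s b) κ = l' - b α`, with
    -- coefficient `l`.
    have h2 := inv_rank_one_mul (a := a s) (b := b s) (l := l) (l' := l') (α := l / a s)
      (κ := (l' - b s * (l / a s)) / l) hPw hβw (by field_simp) (by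
        have : a s = l - s * b s := by rw [hl]; ring
        field_simp
        rw [this]; ring) (hg ▸ hunit)
    rw [← hg] at h2
    rw [h2]

/-- Transfers sign information on the Hessian to its matrix, as `trace_inv_mul_nonpos` requires. -/
theorem halfHessian_quadratic_form (F : N → E) (p : N) (x : Fin d → ℝ) :
    x ⬝ᵥ ((Matrix.of fun i j => halfHessian d F p (EuclideanSpace.single i 1)
      (EuclideanSpace.single j 1)) *ᵥ x) =
      halfHessian d F p (WithLp.toLp 2 x) (WithLp.toLp 2 x) := by
  have hl : ∀ (X Y : EuclideanSpace ℝ (Fin d)), diff d F p (X + Y) = diff d F p X + diff d F p Y :=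
    fun X Y => map_add (mfderiv (𝓡 d) 𝓘(ℝ, E) F p) X Y
  have hm : ∀ (r : ℝ) (X : EuclideanSpace ℝ (Fin d)), diff d F p (r • X) = r • diff d F p X :=
    fun r X => map_smul (mfderiv (𝓡 d) 𝓘(ℝ, E) F p) r X
  exact dotProduct_mulVec_bilin (LinearMap.mk₂ ℝ (halfHessian d F p)
    (fun X Y Z => by simp only [halfHessian, hl, map_add, inner_add_left, inner_add_right,
      _root_.add_apply]; ring)
    (fun r X Y => by simp only [halfHessian, hm, map_smul, inner_smul_left, inner_smul_right,
      _root_.smul_apply, RCLike.conj_to_real, smul_eq_mul]; ring)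
    (fun X Y Z => by simp only [halfHessian, hl, map_add, inner_add_right]; ring)
    (fun r X Y => by simp only [halfHessian, hm, map_smul, inner_smul_right, smul_eq_mul]; ring)) x

/-- The mean curvature vector at a critical point of `‖F‖ ^ 2`. -/
theorem exists_meanCurvature_smul_of_critical (h : IsRadialKahler J a b b' G)
    [IsManifold (𝓡 d) ∞ N] (hd : Module.finrank ℝ E = d + 1) {F ν : N → E}
    (hF : ContMDiff (𝓡 d) 𝓘(ℝ, E) ∞ F) (hν : IsUnitNormal d G F ν) {p : N}
    (hinj : Function.Injective (diff d F p)) (h0 : F p ≠ 0)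
    (hcrit : ∀ X, ⟪F p, diff d F p X⟫ = 0) :
    ∃ k : ℝ, meanCurvature d G F ν p • ν p =
        ((k - radialSpeed a b b' d (‖F p‖ ^ 2)) / ‖F p‖ ^ 2) • F p ∧
      ((∀ X, halfHessian d F p X X ≤ 0) → k ≤ 0) ∧ ((∀ X, 0 ≤ halfHessian d F p X X) → 0 ≤ k) ∧
      ((∀ X Y, halfHessian d F p X Y = 0) →
        normSqA d G F ν p = sphereNormSqA a b b' d (‖F p‖ ^ 2)) := by
  obtain ⟨c, β, w, hc, hc1, hβw, hpos, hshape⟩ :=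
    h.shapeOperator_of_critical hd hF hν hinj h0 hcrit rfl rfl rfl
  have hs0 : 0 < ‖F p‖ ^ 2 := by positivity
  set s := ‖F p‖ ^ 2
  have ha := h.a_pos _ hs0
  have hl := h.radial_pos _ hs0
  set l := a s + s * b s with hldef
  set l' := 2 * b s + s * b' s with hl'
  set M : Matrix (Fin d) (Fin d) ℝ := Matrix.of fun i j => halfHessian d F p
    (EuclideanSpace.single i 1) (EuclideanSpace.single j 1) with hM
  -- The eigenvalue in the Hopf direction; it simplifies because `l - s b = a`.
  have hκ : l / a s + (l' - b s * (l / a s)) / l * s = 1 + s * l' / l := by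
    have : a s = l - s * b s := by rw [hldef]; ring
    field_simp
    rw [this]; ring
  refine ⟨((inducedMetric d G F p)⁻¹ * M).trace, ?_, fun hX => ?_, fun hX => ?_, fun hX => ?_⟩
  · rw [hc, smul_smul]
    congr 1
    rw [meanCurvature, hshape, Matrix.trace_smul, Matrix.trace_sub, Matrix.trace_smul,
      trace_rank_one hβw, Fintype.card_fin, radialSpeed, ← hldef, ← hl']
    have h2 : l / a s * d + (l' - b s * (l / a s)) / l * s =
        (d - 1) * (l / a s) + 1 + s * l' / l := by linear_combination hκ
    rw [h2]
    set q := (d - 1) * (l / a s) + 1 + s * l' / l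
    simp only [smul_eq_mul]
    -- Only `c ^ 2` enters, so the choice of sign of the unit normal does not matter.
    have hcc : c ^ 2 = 1 / (l * s) := by field_simp; linarith
    have : ∀ τ : ℝ, c * (l * τ - q) * c = c ^ 2 * (l * τ - q) := fun τ => by ring
    rw [this, hcc]
    field_simp
  · exact trace_inv_mul_nonpos hpos fun x => by
      rw [hM, halfHessian_quadratic_form]; exact hX _
  · have := trace_inv_mul_nonpos (H := -M) hpos fun x => by
      rw [Matrix.neg_mulVec, dotProduct_neg, hM, halfHessian_quadratic_form]
      linarith [hX (WithLp.toLp 2 x)]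
    rw [Matrix.mul_neg, Matrix.trace_neg] at this
    linarith
  · have hM0 : M = 0 := by ext i j; exact hX _ _
    rw [normSqA, hshape, hM0, Matrix.mul_zero, smul_zero, zero_sub, Matrix.smul_mul,
      Matrix.mul_smul, neg_mul_neg, Matrix.trace_smul, Matrix.trace_smul,
      trace_rank_one_mul_self hβw, Fintype.card_fin, hκ, sphereNormSqA, ← hldef, ← hl',
      smul_smul, ← sq]
    have hcc : c ^ 2 = 1 / (l * s) := by field_simp; linarith
    rw [hcc, smul_eq_mul]
    ring

end IsRadialKahler

/-! ### Extremum conditions transported from the chart to the manifold. -/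

section Extremum

variable {E : Type*} [NormedAddCommGroup E] {d : ℕ}
  {N : Type*} [TopologicalSpace N] [ChartedSpace (EuclideanSpace ℝ (Fin d)) N] {F : N → E} {p : N}

theorem isLocalMax_comp_chart_symm (h : IsLocalMax (fun q => ‖F q‖ ^ 2) p) :
    IsLocalMax (fun y => ‖(F ∘ (chartAt (EuclideanSpace ℝ (Fin d)) p).symm) y‖ ^ 2)
      (chartAt (EuclideanSpace ℝ (Fin d)) p p) := by
  filter_upwards [eventually_chart h] with y hy
  rwa [Function.comp_apply, Function.comp_apply,
    (chartAt (EuclideanSpace ℝ (Fin d)) p).left_inv (mem_chart_source _ p)]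

theorem isLocalMin_comp_chart_symm (h : IsLocalMin (fun q => ‖F q‖ ^ 2) p) :
    IsLocalMin (fun y => ‖(F ∘ (chartAt (EuclideanSpace ℝ (Fin d)) p).symm) y‖ ^ 2)
      (chartAt (EuclideanSpace ℝ (Fin d)) p p) := by
  filter_upwards [eventually_chart h] with y hy
  rwa [Function.comp_apply, Function.comp_apply,
    (chartAt (EuclideanSpace ℝ (Fin d)) p).left_inv (mem_chart_source _ p)]

variable [InnerProductSpace ℝ E]

theorem halfHessian_eq (hF : ContMDiff (𝓡 d) 𝓘(ℝ, E) ∞ F) (X Y : EuclideanSpace ℝ (Fin d)) :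
    halfHessian d F p X Y =
      ⟪fderiv ℝ (F ∘ (chartAt (EuclideanSpace ℝ (Fin d)) p).symm)
          (chartAt (EuclideanSpace ℝ (Fin d)) p p) X,
        fderiv ℝ (F ∘ (chartAt (EuclideanSpace ℝ (Fin d)) p).symm)
          (chartAt (EuclideanSpace ℝ (Fin d)) p p) Y⟫ +
      ⟪(F ∘ (chartAt (EuclideanSpace ℝ (Fin d)) p).symm) (chartAt (EuclideanSpace ℝ (Fin d)) p p),
        fderiv ℝ (fderiv ℝ (F ∘ (chartAt (EuclideanSpace ℝ (Fin d)) p).symm))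
          (chartAt (EuclideanSpace ℝ (Fin d)) p p) X Y⟫ := by
  rw [halfHessian, diff_eq_fderiv (hF.mdifferentiableAt (x := p) (by simp)), Function.comp_apply,
    (chartAt (EuclideanSpace ℝ (Fin d)) p).left_inv (mem_chart_source _ p)]

variable [IsManifold (𝓡 d) ∞ N]

theorem contDiffAt_two_chart (hF : ContMDiff (𝓡 d) 𝓘(ℝ, E) ∞ F) (p : N) :
    ContDiffAt ℝ 2 (F ∘ (chartAt (EuclideanSpace ℝ (Fin d)) p).symm)
      (chartAt (EuclideanSpace ℝ (Fin d)) p p) :=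
  contDiffAt_infty.mp (contDiffAt_comp_chart_symm hF p (mem_chart_target _ p)) 2

theorem inner_diff_eq_zero_of_isLocalExtr (hF : ContMDiff (𝓡 d) 𝓘(ℝ, E) ∞ F)
    (h : IsLocalExtr (fun q => ‖F q‖ ^ 2) p) (X : EuclideanSpace ℝ (Fin d)) :
    ⟪F p, diff d F p X⟫ = 0 := by
  have := inner_fderiv_eq_zero_of_isLocalExtr
    ((contDiffAt_two_chart hF p).differentiableAt (by norm_num))
    (h.imp isLocalMin_comp_chart_symm isLocalMax_comp_chart_symm) X
  rwa [Function.comp_apply,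
    (chartAt (EuclideanSpace ℝ (Fin d)) p).left_inv (mem_chart_source _ p),
    ← diff_eq_fderiv (hF.mdifferentiableAt (x := p) (by simp))] at this

theorem halfHessian_nonpos (hF : ContMDiff (𝓡 d) 𝓘(ℝ, E) ∞ F)
    (h : IsLocalMax (fun q => ‖F q‖ ^ 2) p) (X : EuclideanSpace ℝ (Fin d)) :
    halfHessian d F p X X ≤ 0 := by
  rw [halfHessian_eq hF]
  exact hessian_norm_sq_nonpos (contDiffAt_two_chart hF p) (isLocalMax_comp_chart_symm h) X

theorem halfHessian_nonneg (hF : ContMDiff (𝓡 d) 𝓘(ℝ, E) ∞ F)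
    (h : IsLocalMin (fun q => ‖F q‖ ^ 2) p) (X : EuclideanSpace ℝ (Fin d)) :
    0 ≤ halfHessian d F p X X := by
  rw [halfHessian_eq hF]
  exact hessian_norm_sq_nonneg (contDiffAt_two_chart hF p) (isLocalMin_comp_chart_symm h) X

theorem halfHessian_eq_zero (hF : ContMDiff (𝓡 d) 𝓘(ℝ, E) ∞ F)
    (h : ∀ᶠ q in 𝓝 p, ‖F q‖ ^ 2 = ‖F p‖ ^ 2) (X Y : EuclideanSpace ℝ (Fin d)) :
    halfHessian d F p X Y = 0 := by
  rw [halfHessian_eq hF]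
  refine hessian_norm_sq_eq_zero (contDiffAt_two_chart hF p) ?_ X Y
  filter_upwards [eventually_chart h] with y hy
  rwa [Function.comp_apply, Function.comp_apply,
    (chartAt (EuclideanSpace ℝ (Fin d)) p).left_inv (mem_chart_source _ p)]

end Extremum

/-! ### Concentric spheres as barriers. -/

namespace IsRadialKahler

variable {E : Type*} [NormedAddCommGroup E] [InnerProductSpace ℝ E]
  {J : E →L[ℝ] E} {a b b' : ℝ → ℝ} {G : E → E → E → ℝ} {d : ℕ}
  {N : Type*} [TopologicalSpace N] [ChartedSpace (EuclideanSpace ℝ (Fin d)) N]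
  [IsManifold (𝓡 d) ∞ N] {F ν : N → E} {p : N}

/-- Where `‖F‖` is largest, the hypersurface moves inwards at least as fast as the sphere through
that point. -/
theorem inner_meanCurvature_le_of_isLocalMax (h : IsRadialKahler J a b b' G)
    (hd : Module.finrank ℝ E = d + 1) (hF : ContMDiff (𝓡 d) 𝓘(ℝ, E) ∞ F)
    (hν : IsUnitNormal d G F ν) (hinj : Function.Injective (diff d F p)) (h0 : F p ≠ 0)
    (hmax : IsLocalMax (fun q => ‖F q‖ ^ 2) p) :
    ⟪F p, meanCurvature d G F ν p • ν p⟫ ≤ -radialSpeed a b b' d (‖F p‖ ^ 2) := by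
  obtain ⟨k, hk, hk0, -, -⟩ := h.exists_meanCurvature_smul_of_critical hd hF hν hinj h0
    (inner_diff_eq_zero_of_isLocalExtr hF (Or.inr hmax))
  have hs0 : 0 < ‖F p‖ ^ 2 := by positivity
  rw [hk, inner_smul_right, real_inner_self_eq_norm_sq, div_mul_cancel₀ _ hs0.ne']
  linarith [hk0 (halfHessian_nonpos hF hmax)]

/-- Where `‖F‖` is smallest, the hypersurface moves inwards at most as fast as the sphere through
that point. -/
theorem le_inner_meanCurvature_of_isLocalMin (h : IsRadialKahler J a b b' G)
    (hd : Module.finrank ℝ E = d + 1) (hF : ContMDiff (𝓡 d) 𝓘(ℝ, E) ∞ F)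
    (hν : IsUnitNormal d G F ν) (hinj : Function.Injective (diff d F p)) (h0 : F p ≠ 0)
    (hmin : IsLocalMin (fun q => ‖F q‖ ^ 2) p) :
    -radialSpeed a b b' d (‖F p‖ ^ 2) ≤ ⟪F p, meanCurvature d G F ν p • ν p⟫ := by
  obtain ⟨k, hk, -, hk0, -⟩ := h.exists_meanCurvature_smul_of_critical hd hF hν hinj h0
    (inner_diff_eq_zero_of_isLocalExtr hF (Or.inl hmin))
  have hs0 : 0 < ‖F p‖ ^ 2 := by positivity
  rw [hk, inner_smul_right, real_inner_self_eq_norm_sq, div_mul_cancel₀ _ hs0.ne']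
  linarith [hk0 (halfHessian_nonneg hF hmin)]

/-- Mean curvature vector and `|A|²` of a hypersurface contained in a sphere. -/
theorem meanCurvature_smul_of_norm_sq_const (h : IsRadialKahler J a b b' G)
    (hd : Module.finrank ℝ E = d + 1) (hF : ContMDiff (𝓡 d) 𝓘(ℝ, E) ∞ F)
    (hν : IsUnitNormal d G F ν) (hinj : Function.Injective (diff d F p)) (h0 : F p ≠ 0)
    (hconst : ∀ q, ‖F q‖ ^ 2 = ‖F p‖ ^ 2) :
    meanCurvature d G F ν p • ν p = (-radialSpeed a b b' d (‖F p‖ ^ 2) / ‖F p‖ ^ 2) • F p ∧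
      normSqA d G F ν p = sphereNormSqA a b b' d (‖F p‖ ^ 2) := by
  have hmax : IsLocalMax (fun q => ‖F q‖ ^ 2) p := Eventually.of_forall fun q => (hconst q).le
  obtain ⟨k, hk, hk1, hk2, hk3⟩ := h.exists_meanCurvature_smul_of_critical hd hF hν hinj h0
    (inner_diff_eq_zero_of_isLocalExtr hF (Or.inr hmax))
  have hz := halfHessian_eq_zero (p := p) hF (Eventually.of_forall hconst)
  have : k = 0 := le_antisymm (hk1 fun X => (hz X X).le) (hk2 fun X => (hz X X).ge)
  exact ⟨by rw [hk, this, zero_sub], hk3 hz⟩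

end IsRadialKahler

/-! ### The maximum principle. -/

theorem derivWithin_nonneg_of_isMaxOn {f : ℝ → ℝ} {f' t : ℝ} (ht : 0 < t)
    (hf : HasDerivWithinAt f f' (Icc 0 t) t) (hmax : ∀ s ∈ Icc 0 t, f s ≤ f t) : 0 ≤ f' := by
  have h1 := (hasDerivWithinAt_iff_tendsto_slope' (by simp)).mp (hf.mono Ico_subset_Icc_self)
  rw [nhdsWithin_Ico_eq_nhdsLT ht] at h1
  refine ge_of_tendsto h1 ?_
  filter_upwards [Ico_mem_nhdsLT ht] with s hs
  rw [slope_def_field]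
  have := hmax s ⟨hs.1, hs.2.le⟩
  exact div_nonneg_of_nonpos (by linarith) (by linarith [hs.2])

/-- The maximum principle in the form of Hamilton's trick: a function on a compact space which
satisfies `∂ₜ v ≤ K v` at its positive spatial maxima stays nonpositive. -/
theorem nonpos_of_deriv_le_at_max {N : Type*} [TopologicalSpace N] [CompactSpace N]
    {v v' : ℝ → N → ℝ} {t₁ K : ℝ}
    (hv : ContinuousOn (fun q : N × ℝ => v q.2 q.1) (univ ×ˢ Icc 0 t₁))
    (h0 : ∀ p, v 0 p ≤ 0)
    (hder : ∀ t ∈ Icc 0 t₁, ∀ p, HasDerivWithinAt (fun s => v s p) (v' t p) (Icc 0 t₁) t)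
    (hmax : ∀ t ∈ Icc 0 t₁, ∀ p, (∀ q, v t q ≤ v t p) → 0 < v t p → v' t p ≤ K * v t p)
    {t : ℝ} (ht : t ∈ Icc 0 t₁) (p : N) : v t p ≤ 0 := by
  -- The rate `K + 1` instead of `K` makes `w` strictly decreasing in time at a positive maximum.
  -- This contradicts the nonnegative left derivative at a space-time maximum.
  set w : N × ℝ → ℝ := fun q => Real.exp (-(K + 1) * q.2) * v q.2 q.1
  have hw : ContinuousOn w (univ ×ˢ Icc 0 t₁) := by
    refine ContinuousOn.mul ?_ hv
    fun_prop
  obtain ⟨⟨p₀, t₀⟩, hmem, hmx⟩ := (isCompact_univ.prod isCompact_Icc).exists_isMaxOn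
    ⟨(p, t), mem_univ _, ht⟩ hw
  have ht₀ : t₀ ∈ Icc 0 t₁ := hmem.2
  have hle : ∀ q s, s ∈ Icc 0 t₁ → w (q, s) ≤ w (p₀, t₀) := fun q s hs => hmx ⟨mem_univ _, hs⟩
  have hexp : ∀ s : ℝ, 0 < Real.exp (-(K + 1) * s) := fun s => Real.exp_pos _
  by_contra! hpos
  have hpos₀ : 0 < v t₀ p₀ := by
    have : 0 < w (p₀, t₀) := (mul_pos (hexp t) hpos).trans_le (hle p t ht)
    exact (pos_iff_pos_of_mul_pos this).mp (hexp t₀)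
  have ht₀pos : 0 < t₀ := by
    refine lt_of_le_of_ne ht₀.1 fun h => ?_
    rw [← h] at hpos₀
    exact absurd (h0 p₀) (not_le.mpr hpos₀)
  have hspace : ∀ q, v t₀ q ≤ v t₀ p₀ := fun q =>
    le_of_mul_le_mul_left (hle q t₀ ht₀) (hexp t₀)
  have h1 := hmax t₀ ht₀ p₀ hspace hpos₀
  have hd : HasDerivWithinAt (fun s => w (p₀, s))
      (Real.exp (-(K + 1) * t₀) * (-(K + 1)) * v t₀ p₀ + Real.exp (-(K + 1) * t₀) * v' t₀ p₀)
      (Icc 0 t₀) t₀ := by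
    have he : HasDerivAt (fun s : ℝ => Real.exp (-(K + 1) * s))
        (Real.exp (-(K + 1) * t₀) * (-(K + 1))) t₀ := by
      simpa using ((hasDerivAt_id t₀).const_mul (-(K + 1))).exp
    exact he.hasDerivWithinAt.mul ((hder t₀ ht₀ p₀).mono (Icc_subset_Icc_right ht₀.2))
  have h2 := derivWithin_nonneg_of_isMaxOn ht₀pos hd
    fun s hs => hle p₀ s ⟨hs.1, hs.2.trans ht₀.2⟩
  have h3 : 0 ≤ Real.exp (-(K + 1) * t₀) * (v' t₀ p₀ - (K + 1) * v t₀ p₀) := by linarith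
  have h4 := (mul_nonneg_iff_of_pos_left (hexp t₀)).mp h3
  linarith

/-! ### Rigidity of flows that start on a sphere. -/

section Flow

variable {E : Type*} [NormedAddCommGroup E] [InnerProductSpace ℝ E]
  {J : E →L[ℝ] E} {a b b' : ℝ → ℝ} {G : E → E → E → ℝ} {d : ℕ}
  {N : Type*} [TopologicalSpace N] [ChartedSpace (EuclideanSpace ℝ (Fin d)) N]

theorem IsMeanCurvatureFlow.contMDiff {U : Set E} {T : ℝ} {F ν : ℝ → N → E}
    (hF : IsMeanCurvatureFlow d U G T F ν) {t : ℝ} (ht : t ∈ Ico 0 T) :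
    ContMDiff (𝓡 d) 𝓘(ℝ, E) ∞ (F t) := by
  have h1 : ContMDiff (𝓡 d) ((𝓡 d).prod 𝓘(ℝ, ℝ)) ∞ (fun p : N => (p, t)) :=
    contMDiff_id.prodMk contMDiff_const
  exact hF.smooth.comp_contMDiff h1 fun p => ⟨mem_univ _, ht⟩

variable [IsManifold (𝓡 d) ∞ N] [CompactSpace N]

/-- A mean curvature flow starting on a sphere stays on the concentric spheres whose radii solve
the corresponding ordinary differential equation. -/
theorem IsRadialKahler.norm_sq_eq_of_flow (h : IsRadialKahler J a b b' G)
    (hd : Module.finrank ℝ E = d + 1) {ρ : ℝ → ℝ} (hρ : ∀ s, 0 < s → radialSpeed a b b' d s = ρ s)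
    (hρs : ContDiffOn ℝ 1 ρ (Ioi 0)) {T T' : ℝ} {s : ℝ → ℝ}
    (hs : ∀ t ∈ Ico 0 T, 0 < s t ∧ HasDerivAt s (-(2 * ρ (s t))) t)
    {F ν : ℝ → N → E} (hF : IsMeanCurvatureFlow d {0}ᶜ G T' F ν)
    (h0 : ∀ p, ‖F 0 p‖ ^ 2 = s 0) {t : ℝ} (ht : t ∈ Ico 0 T) (ht' : t < T') (p : N) :
    ‖F t p‖ ^ 2 = s t := by
  have hsub : Icc 0 t ⊆ Ico 0 T := fun x hx => ⟨hx.1, hx.2.trans_lt ht.2⟩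
  have hsub' : Icc 0 t ⊆ Ico 0 T' := fun x hx => ⟨hx.1, hx.2.trans_lt ht'⟩
  have htt : t ∈ Icc 0 t := ⟨ht.1, le_rfl⟩
  have hucont : ContinuousOn (fun q : N × ℝ => ‖F q.2 q.1‖ ^ 2) (univ ×ˢ Icc 0 t) :=
    ((hF.smooth.continuousOn.mono (prod_mono_right hsub')).norm).pow 2
  have hscont : ContinuousOn s (Icc 0 t) := fun x hx =>
    (hs x (hsub hx)).2.continuousAt.continuousWithinAt
  have hscont' : ContinuousOn (fun q : N × ℝ => s q.2) (univ ×ˢ Icc 0 t) :=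
    hscont.comp continuousOn_snd fun q hq => hq.2
  have hupos : ∀ x ∈ Icc 0 t, ∀ q, 0 < ‖F x q‖ ^ 2 := fun x hx q => by
    have : F x q ≠ 0 := hF.mem x (hsub' hx) q
    positivity
  have hcompact : IsCompact ((univ : Set N) ×ˢ Icc 0 t) := isCompact_univ.prod isCompact_Icc
  have hne : ((univ : Set N) ×ˢ Icc 0 t).Nonempty := ⟨(p, t), mem_univ _, htt⟩
  -- `ρ` is Lipschitz only on compact intervals in `(0, ∞)`, so both `‖F‖ ^ 2` and `s` are trapped
  -- in one such interval `[lo, hi]`.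
  obtain ⟨q₁, hq₁, hmin⟩ := hcompact.exists_isMinOn hne (hucont.inf hscont')
  obtain ⟨q₂, hq₂, hmax⟩ := hcompact.exists_isMaxOn hne (hucont.sup hscont')
  set lo := min (‖F q₁.2 q₁.1‖ ^ 2) (s q₁.2) with hlo
  set hi := max (‖F q₂.2 q₂.1‖ ^ 2) (s q₂.2) with hhi
  have hlopos : 0 < lo := lt_min (hupos _ hq₁.2 _) (hs _ (hsub hq₁.2)).1
  have humem : ∀ x ∈ Icc 0 t, ∀ q, ‖F x q‖ ^ 2 ∈ Icc lo hi := fun x hx q =>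
    ⟨(hmin (⟨mem_univ _, hx⟩ : (q, x) ∈ univ ×ˢ Icc 0 t)).trans (min_le_left _ _),
      (le_max_left _ _).trans (hmax (⟨mem_univ _, hx⟩ : (q, x) ∈ univ ×ˢ Icc 0 t))⟩
  have hsmem : ∀ x ∈ Icc 0 t, s x ∈ Icc lo hi := fun x hx =>
    ⟨(hmin (⟨mem_univ _, hx⟩ : (p, x) ∈ univ ×ˢ Icc 0 t)).trans (min_le_right _ _),
      (le_max_right _ _).trans (hmax (⟨mem_univ _, hx⟩ : (p, x) ∈ univ ×ˢ Icc 0 t))⟩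
  obtain ⟨K, hK⟩ := (hρs.mono fun x (hx : x ∈ Icc lo hi) =>
    hlopos.trans_le hx.1).exists_lipschitzOnWith one_ne_zero (convex_Icc lo hi) isCompact_Icc
  have hlip : ∀ x ∈ Icc lo hi, ∀ y ∈ Icc lo hi, |ρ x - ρ y| ≤ K * |x - y| := fun x hx y hy => by
    simpa [Real.dist_eq] using hK.dist_le_mul x hx y hy
  have huder : ∀ x ∈ Icc 0 t, ∀ q, HasDerivWithinAt (fun y => ‖F y q‖ ^ 2)
      (2 * ⟪F x q, meanCurvature d G (F x) (ν x) q • ν x q⟫) (Icc 0 t) x := fun x hx q =>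
    ((hF.evolution x (hsub' hx) q).mono hsub').norm_sq
  have hsder : ∀ x ∈ Icc 0 t, HasDerivWithinAt s (-(2 * ρ (s x))) (Icc 0 t) x := fun x hx =>
    (hs x (hsub hx)).2.hasDerivWithinAt
  apply le_antisymm
  -- The factor `2` comes from differentiating `‖F‖ ^ 2`. Since `s` is constant in space, spatial
  -- maxima of the difference are those of `‖F‖ ^ 2`.
  · refine sub_nonpos.mp (nonpos_of_deriv_le_at_max (K := 2 * K)
      (v := fun x q => ‖F x q‖ ^ 2 - s x) (hucont.sub hscont') (fun q => by simp [h0])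
      (fun x hx q => (huder x hx q).sub (hsder x hx)) (fun x hx q hq hpos => ?_) htt p)
    have h1 := h.inner_meanCurvature_le_of_isLocalMax hd (hF.contMDiff (hsub' hx))
      (hF.unitNormal x (hsub' hx)) (hF.immersion x (hsub' hx) q) (hF.mem x (hsub' hx) q)
      (Eventually.of_forall fun q' => by simpa using hq q')
    rw [hρ _ (hupos x hx q)] at h1
    have h2 := (abs_le.mp (hlip _ (humem x hx q) _ (hsmem x hx))).1
    rw [abs_of_pos hpos] at h2
    linarith
  · refine sub_nonpos.mp (nonpos_of_deriv_le_at_max (K := 2 * K)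
      (v := fun x q => s x - ‖F x q‖ ^ 2) (hscont'.sub hucont) (fun q => by simp [h0])
      (fun x hx q => (hsder x hx).sub (huder x hx q)) (fun x hx q hq hpos => ?_) htt p)
    have h1 := h.le_inner_meanCurvature_of_isLocalMin hd (hF.contMDiff (hsub' hx))
      (hF.unitNormal x (hsub' hx)) (hF.immersion x (hsub' hx) q) (hF.mem x (hsub' hx) q)
      (Eventually.of_forall fun q' => (sub_le_sub_iff_left _).mp (hq q'))
    rw [hρ _ (hupos x hx q)] at h1
    have h2 := (abs_le.mp (hlip _ (hsmem x hx) _ (humem x hx q))).1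
    rw [abs_of_pos hpos] at h2
    linarith

/-- Once the image lies in a sphere, the velocity is a multiple of `F` with the same logarithmic
derivative as `√s`, so `F / √s` has zero time derivative. -/
theorem IsRadialKahler.eq_smul_of_flow (h : IsRadialKahler J a b b' G)
    (hd : Module.finrank ℝ E = d + 1) {ρ : ℝ → ℝ} (hρ : ∀ s, 0 < s → radialSpeed a b b' d s = ρ s)
    (hρs : ContDiffOn ℝ 1 ρ (Ioi 0)) {T T' : ℝ} {s : ℝ → ℝ}
    (hs : ∀ t ∈ Ico 0 T, 0 < s t ∧ HasDerivAt s (-(2 * ρ (s t))) t)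
    {F ν : ℝ → N → E} (hF : IsMeanCurvatureFlow d {0}ᶜ G T' F ν)
    (h0 : ∀ p, ‖F 0 p‖ ^ 2 = s 0) {t : ℝ} (ht : t ∈ Ico 0 T) (ht' : t < T') (p : N) :
    F t p = (√(s t) / √(s 0)) • F 0 p := by
  have hsub : Icc 0 t ⊆ Ico 0 T := fun x hx => ⟨hx.1, hx.2.trans_lt ht.2⟩
  have hsub' : Icc 0 t ⊆ Ico 0 T' := fun x hx => ⟨hx.1, hx.2.trans_lt ht'⟩
  have hu : ∀ x ∈ Icc 0 t, ∀ q, ‖F x q‖ ^ 2 = s x := fun x hx q =>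
    h.norm_sq_eq_of_flow hd hρ hρs hs hF h0 (hsub hx) (hsub' hx).2 q
  have hder : ∀ x ∈ Icc 0 t, HasDerivWithinAt (fun y => (√(s y))⁻¹ • F y p) 0 (Icc 0 t) x := by
    intro x hx
    obtain ⟨hpos, hsd⟩ := hs x (hsub hx)
    have hev := (hF.evolution x (hsub' hx) p).mono hsub'
    rw [(h.meanCurvature_smul_of_norm_sq_const hd (hF.contMDiff (hsub' hx))
      (hF.unitNormal x (hsub' hx)) (hF.immersion x (hsub' hx) p) (hF.mem x (hsub' hx) p)
      (fun q => (hu x hx q).trans (hu x hx p).symm)).1, hu x hx p, hρ _ hpos] at hev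
    have hsq : 0 < √(s x) := Real.sqrt_pos.mpr hpos
    have hi := ((hsd.sqrt hpos.ne').inv hsq.ne').hasDerivWithinAt (s := Icc 0 t)
    refine (hi.smul hev).congr_deriv ?_
    simp only [Pi.inv_apply]
    rw [smul_smul, ← add_smul]
    convert zero_smul ℝ (F x p) using 2
    have hss : √(s x) ^ 2 = s x := Real.sq_sqrt hpos.le
    field_simp
    rw [hss]
    ring
  have hconst := constant_of_derivWithin_zero (fun x hx => (hder x hx).differentiableWithinAt)
    (fun x hx => (hder x ⟨hx.1, hx.2.le⟩).derivWithin
      (uniqueDiffOn_Icc (hx.1.trans_lt hx.2) x ⟨hx.1, hx.2.le⟩)) t ⟨ht.1, le_rfl⟩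
  have hst : 0 < √(s t) := Real.sqrt_pos.mpr (hs t ht).1
  rw [div_eq_mul_inv, ← smul_smul, ← hconst, smul_smul, mul_inv_cancel₀ hst.ne', one_smul]

end Flow

/-! ### The ordinary differential equation for the squared radius. -/

theorem contDiffOn_infty_of_deriv_eq_comp {σ Φ : ℝ → ℝ} {U V : Set ℝ} (hU : IsOpen U)
    (hΦ : ContDiffOn ℝ ∞ Φ V) (hmaps : MapsTo σ U V)
    (hσ : ∀ t ∈ U, HasDerivAt σ (Φ (σ t)) t) : ContDiffOn ℝ ∞ σ U := by
  have hdiff : DifferentiableOn ℝ σ U := fun t ht =>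
    (hσ t ht).differentiableAt.differentiableWithinAt
  refine contDiffOn_infty.mpr fun n => ?_
  induction n with
  | zero => exact contDiffOn_zero.mpr hdiff.continuousOn
  | succ n ih =>
    refine (contDiffOn_succ_iff_deriv_of_isOpen (n := (n : ℕ∞ω)) hU).mpr ⟨hdiff, by simp, ?_⟩
    exact ((contDiffOn_infty.mp hΦ n).comp ih hmaps).congr fun t ht => (hσ t ht).deriv

/-- A solution of `s' = -Φ(s)` with `Φ > 0` on `[-δ, δ]`, starting at `s₀ ∈ (0, δ)`, reaches `0` in
finite time. -/
theorem exists_solution_reaching_zero {Φ : ℝ → ℝ} {δ s₀ : ℝ} (hs₀ : 0 < s₀) (hs₀δ : s₀ < δ)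
    (hΦ : ContDiffOn ℝ ∞ Φ (Icc (-δ) δ)) (hpos : ∀ s ∈ Icc (-δ) δ, 0 < Φ s) :
    ∃ (T c : ℝ) (s : ℝ → ℝ), 0 < T ∧ 0 < c ∧ Continuous s ∧ s 0 = s₀ ∧ s T = 0 ∧
      (∀ t ∈ Ico 0 T, 0 < s t ∧ s t ≤ s₀ ∧ HasDerivAt s (-Φ (s t)) t ∧ ContDiffAt ℝ ∞ s t ∧
        c * (T - t) ≤ s t) := by
  have hδ : 0 < δ := hs₀.trans hs₀δ
  have hle : -δ ≤ δ := by linarith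
  -- Clamping the argument gives a globally defined continuous speed lying between two positive
  -- constants. The equation can then be solved on all of `ℝ`, even past `s = 0`.
  set Ψ : ℝ → ℝ := fun s => Φ (projIcc (-δ) δ hle s) with hΨ
  have hΨc : Continuous Ψ := hΦ.continuousOn.domRestrict.comp continuous_projIcc
  have hΨpos : ∀ s, 0 < Ψ s := fun s => hpos _ (projIcc (-δ) δ hle s).2
  have hΨeq : ∀ s ∈ Icc (-δ) δ, Ψ s = Φ s := fun s hs => by rw [hΨ]; simp [projIcc_of_mem hle hs]
  obtain ⟨⟨x₁, hx₁⟩, hmin⟩ : ∃ x₁ : Icc (-δ) δ, ∀ x : Icc (-δ) δ, Φ x₁ ≤ Φ x := by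
    obtain ⟨x, hx, h⟩ := isCompact_Icc.exists_isMinOn ⟨-δ, le_rfl, hle⟩ hΦ.continuousOn
    exact ⟨⟨x, hx⟩, fun y => h y.2⟩
  obtain ⟨⟨x₂, hx₂⟩, hmax⟩ : ∃ x₂ : Icc (-δ) δ, ∀ x : Icc (-δ) δ, Φ x ≤ Φ x₂ := by
    obtain ⟨x, hx, h⟩ := isCompact_Icc.exists_isMaxOn ⟨-δ, le_rfl, hle⟩ hΦ.continuousOn
    exact ⟨⟨x, hx⟩, fun y => h y.2⟩
  have hc : 0 < Φ x₁ := hpos _ hx₁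
  have hC : 0 < Φ x₂ := hpos _ hx₂
  -- Separation of variables: `τ` is time as a function of position, and its inverse `σ` solves `σ'
  -- = Ψ(σ)`. The required solution is `σ` run backwards from `T = τ s₀`.
  set τ : ℝ → ℝ := fun s => ∫ x in (0 : ℝ)..s, (Ψ x)⁻¹ with hτ
  have hinvc : Continuous fun x => (Ψ x)⁻¹ := hΨc.inv₀ fun x => (hΨpos x).ne'
  have hτd : ∀ s, HasDerivAt τ (Ψ s)⁻¹ s := fun s =>
    intervalIntegral.integral_hasDerivAt_right (hinvc.intervalIntegrable _ _)
      hinvc.stronglyMeasurable.stronglyMeasurableAtFilter hinvc.continuousAt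
  have hτ0 : τ 0 = 0 := by simp [hτ]
  have hτmono : StrictMono τ := strictMono_of_deriv_pos fun s => by
    rw [(hτd s).deriv]; exact inv_pos.mpr (hΨpos s)
  have hτdiff : Differentiable ℝ τ := fun s => (hτd s).differentiableAt
  have hlower : ∀ x y, x ≤ y → (Φ x₂)⁻¹ * (y - x) ≤ τ y - τ x := fun x y hxy =>
    mul_sub_le_image_sub_of_le_deriv hτdiff (fun s => by
      rw [(hτd s).deriv]; exact inv_anti₀ (hΨpos s) (hmax _)) hxy
  have hsurj : Function.Surjective τ := by
    refine hτdiff.continuous.surjective ?_ ?_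
    · refine tendsto_atTop_mono' _ ?_ (tendsto_id.const_mul_atTop (inv_pos.mpr hC))
      filter_upwards [eventually_ge_atTop 0] with y hy
      have := hlower 0 y hy
      simpa [hτ0] using this
    · refine tendsto_atBot_mono' _ ?_ (tendsto_id.const_mul_atBot (inv_pos.mpr hC))
      filter_upwards [eventually_le_atBot 0] with y hy
      have := hlower y 0 hy
      simp only [hτ0, id] at this ⊢
      linarith
  set e := StrictMono.orderIsoOfSurjective τ hτmono hsurj with he
  set σ : ℝ → ℝ := fun y => e.symm y with hσ
  have hτσ : ∀ y, τ (σ y) = y := fun y => e.apply_symm_apply y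
  have hστ : ∀ x, σ (τ x) = x := fun x => e.symm_apply_apply x
  have hσc : Continuous σ := e.symm.continuous
  have hσd : ∀ y, HasDerivAt σ (Ψ (σ y)) y := fun y => by
    simpa using HasDerivAt.of_local_left_inverse hσc.continuousAt (hτd (σ y))
      (inv_pos.mpr (hΨpos _)).ne' (Eventually.of_forall hτσ)
  have hσmono : StrictMono σ := e.symm.strictMono
  have hσ0 : σ 0 = 0 := by rw [← hτ0, hστ, hτ0]
  set T := τ s₀ with hT
  have hTpos : 0 < T := by rw [← hτ0]; exact hτmono hs₀
  set s : ℝ → ℝ := fun t => σ (T - t) with hs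
  have hsd : ∀ t, HasDerivAt s (-Ψ (s t)) t := fun t => by
    simpa using (hσd (T - t)).comp_const_sub T t
  have hsc : Continuous s := hσc.comp (by fun_prop)
  have hU : IsOpen (s ⁻¹' Ioo (-δ) δ) := isOpen_Ioo.preimage hsc
  -- Smoothness is claimed only where the clamp is inactive, and follows there by bootstrapping the
  -- equation.
  have hsmooth : ContDiffOn ℝ ∞ s (s ⁻¹' Ioo (-δ) δ) :=
    contDiffOn_infty_of_deriv_eq_comp (V := Icc (-δ) δ) hU hΦ.neg
      (fun t ht => Ioo_subset_Icc_self ht) fun t ht => by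
        have := hsd t
        rwa [hΨeq _ (Ioo_subset_Icc_self ht)] at this
  refine ⟨T, Φ x₁, s, hTpos, hc, hsc, ?_, ?_, fun t ht => ?_⟩
  · simp [hs, hT, hστ]
  · simp [hs, hσ0]
  · have h1 : 0 < s t := by
      have := hσmono (sub_pos.mpr ht.2); rwa [hσ0] at this
    have h2 : s t ≤ s₀ := by
      have := hσmono.monotone (sub_le_self T ht.1); rwa [hT, hστ] at this
    have hmem : s t ∈ Ioo (-δ) δ := ⟨by linarith, by linarith⟩
    refine ⟨h1, h2, ?_, hsmooth.contDiffAt (hU.mem_nhds hmem), ?_⟩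
    · rw [← hΨeq _ (Ioo_subset_Icc_self hmem)]; exact hsd t
    · have := mul_sub_le_image_sub_of_le_deriv (f := σ) (C := Φ x₁)
        (fun y => (hσd y).differentiableAt) (fun y => by
          rw [(hσd y).deriv]; exact hmin _) (sub_nonneg.mpr ht.2.le)
      simpa [hσ0] using this

/-! ### The Kähler metric of a radial potential. -/

section Metric

variable {m : ℕ}

theorem S_eq_norm_sq (z : Cm m) : S z = ‖z‖ ^ 2 := (EuclideanSpace.norm_sq_eq z).symm

/-- Multiplication by `√-1`, as a real linear map. -/
noncomputable def complexStructure (m : ℕ) : Cm m →L[ℝ] Cm m :=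
  (Complex.I • ContinuousLinearMap.id ℂ (Cm m)).restrictScalars ℝ

theorem complexStructure_apply (z : Cm m) (i : Fin m) :
    complexStructure m z i = Complex.I * z i := rfl

theorem inner_eq_sum_re (x y : Cm m) :
    ⟪x, y⟫ = (∑ i, (starRingEnd ℂ) (x i) * y i).re := by
  rw [PiLp.inner_apply, Complex.re_sum]
  exact Finset.sum_congr rfl fun i _ => by rw [Complex.inner, mul_comm]

/-- With `inner_eq_sum_re`, this splits the Hermitian product into the two real pairings occurring
in `radialForm`. -/
theorem inner_complexStructure_eq_sum_im (x y : Cm m) :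
    ⟪complexStructure m x, y⟫ = (∑ i, (starRingEnd ℂ) (x i) * y i).im := by
  rw [inner_eq_sum_re, Complex.re_sum, Complex.im_sum]
  refine Finset.sum_congr rfl fun i _ => ?_
  rw [complexStructure_apply]
  simp
  ring

theorem inner_single_one (z : Cm m) (i : Fin m) :
    ⟪z, EuclideanSpace.single i (1 : ℂ)⟫ = (z i).re := by
  rw [inner_eq_sum_re, Finset.sum_eq_single i] <;> simp +contextual

theorem inner_single_I (z : Cm m) (i : Fin m) :
    ⟪z, EuclideanSpace.single i Complex.I⟫ = (z i).im := by
  rw [inner_eq_sum_re, Finset.sum_eq_single i] <;> simp +contextual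

theorem hasFDerivAt_radial {a : ℝ → ℝ} {a' : ℝ} {z : Cm m} (ha : HasDerivAt a a' (S z)) :
    HasFDerivAt (fun w : Cm m => ((a (S w) : ℝ) : ℂ))
      (Complex.ofRealCLM.comp (a' • (2 • innerSL ℝ z))) z := by
  have h1 : HasFDerivAt (fun w : Cm m => S w) (2 • innerSL ℝ z) z := by
    have : (fun w : Cm m => S w) = fun w => ‖w‖ ^ 2 := funext S_eq_norm_sq
    rw [this]
    simpa using (hasFDerivAt_id z).norm_sq
  exact Complex.ofRealCLM.hasFDerivAt.comp z (ha.comp_hasFDerivAt z h1)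

theorem wirtingerBar_radial {f : ℝ → ℝ} {a : ℝ} {z : Cm m} (hf : HasDerivAt f a (S z))
    (j : Fin m) : wirtingerBar j (fun w => ((f (S w) : ℝ) : ℂ)) z = a * z j := by
  rw [wirtingerBar, (hasFDerivAt_radial hf).fderiv]
  simp only [ContinuousLinearMap.comp_apply, _root_.smul_apply, innerSL_apply_apply,
    inner_single_one, inner_single_I, Complex.ofRealCLM_apply]
  have hre : z j = (z j).re + (z j).im * Complex.I := (Complex.re_add_im (z j)).symm
  push_cast [smul_eq_mul, nsmul_eq_mul]
  linear_combination (-a : ℂ) * hre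

theorem wirtinger_wirtingerBar_radial {f a : ℝ → ℝ} {b : ℝ} {z : Cm m}
    (hf : ∀ᶠ w in 𝓝 z, HasDerivAt f (a (S w)) (S w)) (ha : HasDerivAt a b (S z)) (i j : Fin m) :
    wirtinger i (wirtingerBar j (fun w => ((f (S w) : ℝ) : ℂ))) z =
      a (S z) * (if i = j then 1 else 0) + b * ((starRingEnd ℂ) (z i) * z j) := by
  have hev : wirtingerBar j (fun w => ((f (S w) : ℝ) : ℂ)) =ᶠ[𝓝 z]
      fun w => ((a (S w) : ℝ) : ℂ) * w j := by
    filter_upwards [hf] with w hw using wirtingerBar_radial hw j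
  have hproj : HasFDerivAt (fun w : Cm m => w j)
      ((EuclideanSpace.proj j : Cm m →L[ℂ] ℂ).restrictScalars ℝ) z :=
    ((EuclideanSpace.proj j : Cm m →L[ℂ] ℂ).restrictScalars ℝ).hasFDerivAt
  have hd : HasFDerivAt (fun w : Cm m => ((a (S w) : ℝ) : ℂ) * w j) _ z :=
    (hasFDerivAt_radial ha).mul hproj
  rw [wirtinger, hev.fderiv_eq, hd.fderiv]
  simp only [_root_.add_apply, ContinuousLinearMap.comp_apply, _root_.smul_apply,
    innerSL_apply_apply, inner_single_one, inner_single_I, Complex.ofRealCLM_apply,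
    ContinuousLinearMap.coe_restrictScalars', PiLp.proj_apply, smul_eq_mul]
  have hre : (starRingEnd ℂ) (z i) = (z i).re - (z i).im * Complex.I :=
    Complex.ext (by simp) (by simp)
  have hI := Complex.I_mul_I
  by_cases hij : i = j
  · subst hij
    rw [hre]
    simp
    linear_combination (-(a (S z)) / 2 : ℂ) * hI
  · rw [hre]
    simp [hij, Ne.symm hij]
    ring

/-- The complex Hessian `a δᵢⱼ + b z̄ᵢ zⱼ` makes the double sum collapse to `a` times the product of
`u` and `v`, plus `b` times the product of the Hermitian pairings of `z` with `u` and with `v`, the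
latter conjugated. -/
theorem kahlerMetric_radial {f a : ℝ → ℝ} {b : ℝ} {z : Cm m}
    (hf : ∀ᶠ w in 𝓝 z, HasDerivAt f (a (S w)) (S w)) (ha : HasDerivAt a b (S z)) (u v : Cm m) :
    kahlerMetric (fun w => f (S w)) z u v =
      radialForm (complexStructure m) (a (S z)) b z u v := by
  simp only [kahlerMetric, wirtinger_wirtingerBar_radial hf ha]
  have h1 : (∑ i, ∑ j, ((a (S z) : ℂ) * (if i = j then 1 else 0)
        + b * ((starRingEnd ℂ) (z i) * z j)) * u i * (starRingEnd ℂ) (v j)) =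
      a (S z) * ∑ i, u i * (starRingEnd ℂ) (v i)
        + b * ((∑ i, (starRingEnd ℂ) (z i) * u i)
          * (starRingEnd ℂ) (∑ j, (starRingEnd ℂ) (z j) * v j)) := by
    rw [map_sum, Finset.sum_mul_sum, Finset.mul_sum, Finset.mul_sum, ← Finset.sum_add_distrib]
    refine Finset.sum_congr rfl fun i _ => ?_
    rw [Finset.mul_sum]
    have : (a (S z) : ℂ) * (u i * (starRingEnd ℂ) (v i)) =
        ∑ j, (if i = j then (a (S z) : ℂ) * (u i * (starRingEnd ℂ) (v j)) else 0) := by simp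
    rw [this, ← Finset.sum_add_distrib]
    refine Finset.sum_congr rfl fun j _ => ?_
    split_ifs <;> simp <;> ring
  rw [h1, radialForm, inner_eq_sum_re z u, inner_eq_sum_re z v, inner_complexStructure_eq_sum_im,
    inner_complexStructure_eq_sum_im, real_inner_comm, inner_eq_sum_re v u]
  have h2 : ∑ i, u i * (starRingEnd ℂ) (v i) = ∑ i, (starRingEnd ℂ) (v i) * u i :=
    Finset.sum_congr rfl fun i _ => mul_comm _ _
  rw [h2]
  rw [Complex.add_re, Complex.re_ofReal_mul, Complex.re_ofReal_mul, Complex.mul_re,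
    Complex.conj_re, Complex.conj_im]
  ring

theorem hasDerivAt_iterate_deriv {g : ℝ → ℝ} (hg : AnalyticOnNhd ℝ g (Ici 0)) (n : ℕ) {s : ℝ}
    (hs : 0 ≤ s) : HasDerivAt (deriv^[n] g) (deriv^[n + 1] g s) s := by
  have : AnalyticAt ℝ (deriv^[n] g) s := by
    have := (hg s hs).iterated_deriv n
    exact this
  rw [Function.iterate_succ_apply']
  exact this.differentiableAt.hasDerivAt

theorem isRadialKahler_blowUpMetric {g : ℝ → ℝ} (hg : AnalyticOnNhd ℝ g (Ici 0))
    (h1 : ∀ s : ℝ, 0 < s → 0 < 1 / s + deriv g s)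
    (h2 : ∀ s : ℝ, 0 < s → 0 < deriv g s + s * deriv (deriv g) s) :
    IsRadialKahler (complexStructure m) (fun s => s⁻¹ + deriv g s)
      (fun s => -(s ^ 2)⁻¹ + deriv (deriv g) s)
      (fun s => 2 * (s ^ 3)⁻¹ + deriv (deriv (deriv g)) s) (blowUpMetric m g) := by
  have hga : ∀ s : ℝ, 0 < s →
      HasDerivAt (fun s => s⁻¹ + deriv g s) (-(s ^ 2)⁻¹ + deriv (deriv g) s) s := fun s hs =>
    (hasDerivAt_inv hs.ne').add (hasDerivAt_iterate_deriv hg 1 hs.le)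
  refine ⟨fun x y => ?_, fun x y => ?_, hga, fun s hs => ?_, fun s hs => ?_, fun s hs => ?_,
    fun z hz u v => ?_⟩
  · rw [real_inner_comm (complexStructure m y) x, inner_complexStructure_eq_sum_im,
      inner_complexStructure_eq_sum_im, Complex.im_sum, Complex.im_sum, ← Finset.sum_neg_distrib]
    refine Finset.sum_congr rfl fun i _ => ?_
    simp
    ring
  · rw [inner_eq_sum_re, inner_eq_sum_re, Complex.re_sum, Complex.re_sum]
    refine Finset.sum_congr rfl fun i _ => ?_
    simp [complexStructure_apply]
  · refine HasDerivAt.add ?_ (hasDerivAt_iterate_deriv hg 2 hs.le)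
    have := (((hasDerivAt_pow 2 s).inv (by positivity)).neg)
    refine this.congr_deriv ?_
    field_simp
    norm_num
    ring
  · simpa using h1 s hs
  · have := h2 s hs
    have h3 : s⁻¹ + deriv g s + s * (-(s ^ 2)⁻¹ + deriv (deriv g) s) =
        deriv g s + s * deriv (deriv g) s := by field_simp; ring
    rwa [h3]
  · have hSz : 0 < S z := by rw [S_eq_norm_sq]; positivity
    rw [← S_eq_norm_sq]
    refine kahlerMetric_radial (f := fun s => Real.log s + g s)
      (a := fun s => s⁻¹ + deriv g s) ?_ (hga _ hSz) u v
    filter_upwards [isOpen_ne.mem_nhds hz] with w hw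
    have hSw : 0 < S w := by
      have : w ≠ 0 := hw
      rw [S_eq_norm_sq]; positivity
    exact (Real.hasDerivAt_log hSw.ne').add (hasDerivAt_iterate_deriv hg 0 hSw.le)

end Metric

/-! ### Collapse onto the exceptional divisor. -/

section BlowUp

variable {m : ℕ}

/-- Projective space is a continuous image of the unit sphere. Its compactness lets the tube lemma
place a whole neighbourhood of the divisor inside a given open set. -/
instance compactSpace_projectivization (m : ℕ) : CompactSpace (ℙ ℂ (Cm m)) := by
  have hne : ∀ x : UnitSphere m, (x : Cm m) ≠ 0 := fun x h => by
    have := norm_eq_of_mem_sphere x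
    rw [h] at this
    simp at this
  have hcont : Continuous fun x : UnitSphere m =>
      Projectivization.mk' ℂ (⟨x, hne x⟩ : {v : Cm m // v ≠ 0}) :=
    continuous_coinduced_rng.comp (continuous_subtype_val.subtype_mk hne)
  have hsurj : Function.Surjective fun x : UnitSphere m =>
      Projectivization.mk' ℂ (⟨x, hne x⟩ : {v : Cm m // v ≠ 0}) := fun p => by
    have hp := p.rep_nonzero
    have hn : ‖p.rep‖ ≠ 0 := norm_ne_zero_iff.mpr hp
    refine ⟨⟨((‖p.rep‖⁻¹ : ℝ) : ℂ) • p.rep, by simp [norm_smul, hn]⟩, ?_⟩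
    conv_rhs => rw [← p.mk_rep]
    exact (Projectivization.mk_eq_mk_iff' ℂ _ _ _ _).mpr ⟨((‖p.rep‖⁻¹ : ℝ) : ℂ), rfl⟩
  exact ⟨by rw [← hsurj.range_eq]; exact isCompact_range hcont⟩

/-- Spheres whose radii tend to zero converge in the blow up to the exceptional divisor. -/
theorem setsConverge_exceptionalDivisor {A : ℝ → Set (Cm m)} {R : ℝ → ℝ} {T : ℝ}
    (hA : ∀ᶠ t in 𝓝[<] T, 0 ≤ R t ∧ A t = hypersphere m (R t))
    (hR : Tendsto R (𝓝[<] T) (𝓝 0)) :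
    SetsConverge (fun t => (blowDown ⁻¹' A t : Set (BlowUp m))) T (exceptionalDivisor m) := by
  constructor
  · rintro O hO hEO
    obtain ⟨O', hO', rfl⟩ := isOpen_induced_iff.mp hO
    have hsub : ({0} : Set (Cm m)) ×ˢ (univ : Set (ℙ ℂ (Cm m))) ⊆ O' := by
      rintro ⟨z, q⟩ ⟨hz, -⟩
      obtain rfl : z = 0 := hz
      exact hEO (show (⟨(0, q), fun i j => by simp⟩ : BlowUp m) ∈ exceptionalDivisor m from rfl)
    obtain ⟨u, v, hu, -, h0u, huniv, huv⟩ :=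
      generalized_tube_lemma isCompact_singleton isCompact_univ hO' hsub
    obtain ⟨r, hr, hball⟩ := Metric.isOpen_iff.mp hu 0 (h0u rfl)
    filter_upwards [hA, hR.eventually (gt_mem_nhds hr)] with t ht htr q hq
    have hq' : blowDown q ∈ A t := hq
    rw [ht.2, hypersphere, mem_ofPred_eq, S_eq_norm_sq] at hq'
    have hn : ‖blowDown q‖ = R t := (sq_eq_sq₀ (norm_nonneg _) ht.1).mp hq'
    refine huv (⟨hball ?_, huniv (mem_univ _)⟩ : q.1 ∈ u ×ˢ v)
    rw [mem_ball_zero_iff]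
    exact hn.trans_lt htr
  · rintro O hO ⟨q, hqE, hqO⟩
    have hp := q.1.2.rep_nonzero
    have hn : ‖q.1.2.rep‖ ≠ 0 := norm_ne_zero_iff.mpr hp
    set c : ℝ → ℂ := fun t => ((R t / ‖q.1.2.rep‖ : ℝ) : ℂ)
    -- To approach `q` in the divisor, keep its line fixed and move along it, at distance `R t` from
    -- the origin.
    set γ : ℝ → BlowUp m := fun t =>
      ⟨(c t • q.1.2.rep, q.1.2), fun i j => by simp; ring⟩ with hγ
    have hc : Tendsto c (𝓝[<] T) (𝓝 0) := by
      have h1 : Tendsto (fun t => R t / ‖q.1.2.rep‖) (𝓝[<] T) (𝓝 0) := by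
        simpa using hR.div_const ‖q.1.2.rep‖
      have h2 : Tendsto c (𝓝[<] T) (𝓝 ((0 : ℝ) : ℂ)) :=
        (Complex.continuous_ofReal.tendsto 0).comp h1
      rwa [Complex.ofReal_zero] at h2
    have hlim : Tendsto γ (𝓝[<] T) (𝓝 q) := by
      rw [tendsto_subtype_rng]
      refine Tendsto.prodMk_nhds ?_ tendsto_const_nhds
      have hq0 : q.1.1 = 0 := hqE
      rw [hq0]
      simpa using hc.smul_const q.1.2.rep
    filter_upwards [hA, hlim.eventually (hO.mem_nhds hqO)] with t ht hmem
    refine ⟨γ t, ?_, hmem⟩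
    change c t • q.1.2.rep ∈ A t
    rw [ht.2, hypersphere, mem_ofPred_eq, S_eq_norm_sq, norm_smul, Complex.norm_real,
      Real.norm_eq_abs, abs_of_nonneg (div_nonneg ht.1 (norm_nonneg _)), div_mul_cancel₀ _ hn]

end BlowUp

/-! ### The explicit flow by spheres. -/

section SphereFlow

variable {E : Type*} [NormedAddCommGroup E] [InnerProductSpace ℝ E] {d : ℕ}
  [Fact (Module.finrank ℝ E = d + 1)]

theorem contMDiff_smul_coe_sphere (r : ℝ) :
    ContMDiff (𝓡 d) 𝓘(ℝ, E) ∞ (fun x : Metric.sphere (0 : E) 1 => r • (x : E)) :=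
  (contMDiff_const (I' := 𝓘(ℝ, ℝ)) (c := r)).smul contMDiff_coe_sphere

theorem injective_diff_smul_coe_sphere {r : ℝ} (hr : r ≠ 0) (p : Metric.sphere (0 : E) 1) :
    Function.Injective (diff d (fun x : Metric.sphere (0 : E) 1 => r • (x : E)) p) := by
  have h1 : Function.Injective (diff d (fun x : Metric.sphere (0 : E) 1 => (x : E)) p) :=
    injective_mvfderiv_subtypeVal_sphere p
  have h2 : ContMDiff (𝓡 d) 𝓘(ℝ, E) ∞ (fun x : Metric.sphere (0 : E) 1 => (x : E)) :=
    contMDiff_coe_sphere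
  have hcoe := diff_eq_fderiv (h2.mdifferentiableAt (x := p) (by simp))
  have hsmul := diff_eq_fderiv
    ((contMDiff_smul_coe_sphere (d := d) r).mdifferentiableAt (x := p) (by simp))
  have hd : DifferentiableAt ℝ ((fun x : Metric.sphere (0 : E) 1 => (x : E)) ∘
      (chartAt (EuclideanSpace ℝ (Fin d)) p).symm) (chartAt (EuclideanSpace ℝ (Fin d)) p p) :=
    (contDiffAt_comp_chart_symm h2 p (mem_chart_target _ p)).differentiableAt (by simp)
  have heq : diff d (fun x : Metric.sphere (0 : E) 1 => r • (x : E)) p =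
      fun X => r • diff d (fun x : Metric.sphere (0 : E) 1 => (x : E)) p X := by
    rw [hsmul, hcoe]
    ext X
    have : (fun x : Metric.sphere (0 : E) 1 => r • (x : E)) ∘
        (chartAt (EuclideanSpace ℝ (Fin d)) p).symm =
      r • ((fun x : Metric.sphere (0 : E) 1 => (x : E)) ∘
        (chartAt (EuclideanSpace ℝ (Fin d)) p).symm) := rfl
    rw [this, fderiv_const_smul hd]
    rfl
  rw [heq]
  exact (smul_right_injective E hr).comp h1

variable {J : E →L[ℝ] E} {a b b' : ℝ → ℝ} {G : E → E → E → ℝ}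

theorem norm_sq_smul_coe_sphere {s : ℝ} (hs : 0 ≤ s) (x : Metric.sphere (0 : E) 1) :
    ‖√s • (x : E)‖ ^ 2 = s := by
  rw [norm_smul, norm_eq_of_mem_sphere, mul_one, Real.norm_eq_abs, sq_abs, Real.sq_sqrt hs]

/-- A Euclidean unit radial vector has squared `G`-length `a + s b`, because `⟪J z, z⟫ = 0`. For the
same reason radial and tangential vectors are `G`-orthogonal. -/
theorem IsRadialKahler.isUnitNormal_sphere (h : IsRadialKahler J a b b' G) {s : ℝ} (hs : 0 < s) :
    IsUnitNormal d G (fun x : Metric.sphere (0 : E) 1 => √s • (x : E))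
      (fun x => (√(a s + s * b s))⁻¹ • (x : E)) := by
  have hl := h.radial_pos s hs
  have hr : 0 < √s := Real.sqrt_pos.mpr hs
  have hne : ∀ x : Metric.sphere (0 : E) 1, √s • (x : E) ≠ 0 := fun x =>
    smul_ne_zero hr.ne' (ne_zero_of_mem_unit_sphere x)
  have hxx : ∀ x : Metric.sphere (0 : E) 1, ⟪(x : E), (x : E)⟫ = 1 := fun x => by
    rw [real_inner_self_eq_norm_sq, norm_eq_of_mem_sphere, one_pow]
  have hcrit : ∀ (p : Metric.sphere (0 : E) 1) X,
      ⟪√s • (p : E), diff d (fun x : Metric.sphere (0 : E) 1 => √s • (x : E)) p X⟫ = 0 := fun p =>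
    inner_diff_eq_zero_of_isLocalExtr (contMDiff_smul_coe_sphere (√s)) (Or.inr
      (Eventually.of_forall fun q =>
        ((norm_sq_smul_coe_sphere hs.le q).trans (norm_sq_smul_coe_sphere hs.le p).symm).le))
  refine ⟨contMDiff_smul_coe_sphere _, fun p => ?_, fun p X => ?_⟩
  · rw [h.eq_form _ (hne p), radialForm, norm_sq_smul_coe_sphere hs.le]
    simp only [map_smul, inner_smul_left, inner_smul_right, hxx, h.inner_J_self,
      RCLike.conj_to_real]
    have h1 : √s ^ 2 = s := Real.sq_sqrt hs.le
    have h2 : √(a s + s * b s) ^ 2 = a s + s * b s := Real.sq_sqrt hl.le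
    have h3 : 0 < √(a s + s * b s) := Real.sqrt_pos.mpr hl
    field_simp
    rw [h1, h2]
    ring
  · have hX := hcrit p X
    rw [h.eq_form _ (hne p), radialForm, hX]
    rw [inner_smul_left, RCLike.conj_to_real, mul_eq_zero] at hX
    simp only [map_smul, inner_smul_left, inner_smul_right, hX.resolve_left hr.ne',
      h.inner_J_self, mul_zero, zero_mul, add_zero]

/-- The spheres whose squared radii solve `s' = -2 ρ(s)` form a mean curvature flow. -/
theorem IsRadialKahler.isMeanCurvatureFlow_spheres (h : IsRadialKahler J a b b' G)
    {ρ : ℝ → ℝ} (hρ : ∀ s, 0 < s → radialSpeed a b b' d s = ρ s) {T : ℝ} {s : ℝ → ℝ}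
    (hs : ∀ t ∈ Ico 0 T, 0 < s t ∧ HasDerivAt s (-(2 * ρ (s t))) t)
    (hsm : ∀ t ∈ Ico 0 T, ContDiffAt ℝ ∞ s t) :
    IsMeanCurvatureFlow d {0}ᶜ G T (fun t (x : Metric.sphere (0 : E) 1) => √(s t) • (x : E))
      (fun t x => (√(a (s t) + s t * b (s t)))⁻¹ • (x : E)) := by
  have hr : ∀ t ∈ Ico 0 T, 0 < √(s t) := fun t ht => Real.sqrt_pos.mpr (hs t ht).1
  have hne : ∀ t ∈ Ico 0 T, ∀ x : Metric.sphere (0 : E) 1, √(s t) • (x : E) ≠ 0 := fun t ht x =>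
    smul_ne_zero (hr t ht).ne' (ne_zero_of_mem_unit_sphere x)
  refine ⟨?_, hne, fun t ht p => injective_diff_smul_coe_sphere (hr t ht).ne' p,
    fun t ht => h.isUnitNormal_sphere (hs t ht).1, fun t ht p => ?_⟩
  · have h1 : ContMDiffOn 𝓘(ℝ, ℝ) 𝓘(ℝ, ℝ) ∞ (fun t => √(s t)) (Ico 0 T) := by
      rw [contMDiffOn_iff_contDiffOn]
      exact fun t ht => ((hsm t ht).sqrt (hs t ht).1.ne').contDiffWithinAt
    have h2 : ContMDiffOn ((𝓡 d).prod 𝓘(ℝ, ℝ)) 𝓘(ℝ, ℝ) ∞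
        (fun q : Metric.sphere (0 : E) 1 × ℝ => √(s q.2)) (univ ×ˢ Ico 0 T) :=
      h1.comp contMDiffOn_snd fun q hq => hq.2
    have h3 : ContMDiff ((𝓡 d).prod 𝓘(ℝ, ℝ)) 𝓘(ℝ, E) ∞
        (fun q : Metric.sphere (0 : E) 1 × ℝ => (q.1 : E)) :=
      contMDiff_coe_sphere.comp contMDiff_fst
    exact h2.smul h3.contMDiffOn
  · obtain ⟨hpos, hsd⟩ := hs t ht
    rw [(h.meanCurvature_smul_of_norm_sq_const Fact.out (contMDiff_smul_coe_sphere (√(s t)))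
      (h.isUnitNormal_sphere hpos) (injective_diff_smul_coe_sphere (hr t ht).ne' p) (hne t ht p)
      (fun q => by rw [norm_sq_smul_coe_sphere hpos.le, norm_sq_smul_coe_sphere hpos.le])).1,
      norm_sq_smul_coe_sphere hpos.le, hρ _ hpos]
    refine (((hsd.sqrt hpos.ne').smul_const (p : E)).congr_deriv ?_).hasDerivWithinAt
    rw [smul_smul]
    congr 1
    have h1 : √(s t) ^ 2 = s t := Real.sq_sqrt hpos.le
    have h2 := hr t ht
    field_simp
    rw [h1]

theorem IsRadialKahler.normSqA_sphere (h : IsRadialKahler J a b b' G) {s : ℝ} (hs : 0 < s)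
    (p : Metric.sphere (0 : E) 1) :
    normSqA d G (fun x : Metric.sphere (0 : E) 1 => √s • (x : E))
      (fun x => (√(a s + s * b s))⁻¹ • (x : E)) p = sphereNormSqA a b b' d s := by
  have hr : 0 < √s := Real.sqrt_pos.mpr hs
  have := (h.meanCurvature_smul_of_norm_sq_const (d := d) (p := p) Fact.out
    (contMDiff_smul_coe_sphere (√s)) (h.isUnitNormal_sphere hs)
    (injective_diff_smul_coe_sphere hr.ne' p)
    (smul_ne_zero hr.ne' (ne_zero_of_mem_unit_sphere p))
    (fun q => by rw [norm_sq_smul_coe_sphere hs.le, norm_sq_smul_coe_sphere hs.le])).2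
  rwa [norm_sq_smul_coe_sphere hs.le] at this

end SphereFlow

/-! ### Analytic extension of speed and curvature to `s = 0`. -/

section Profile

variable {g : ℝ → ℝ}

/-- The radial coefficient `g' + s g''` of the metric. -/
noncomputable def radialCoeff (g : ℝ → ℝ) (s : ℝ) : ℝ := deriv g s + s * deriv (deriv g) s

/-- The derivative of `radialCoeff`. -/
noncomputable def radialCoeffDeriv (g : ℝ → ℝ) (s : ℝ) : ℝ :=
  2 * deriv (deriv g) s + s * deriv (deriv (deriv g)) s

/-- The analytic extension to `s = 0` of the speed of the spheres. -/
noncomputable def speedProfile (g : ℝ → ℝ) (d : ℕ) (s : ℝ) : ℝ :=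
  ((d - 1) * (s * radialCoeff g s / (1 + s * deriv g s)) + 1
    + s * radialCoeffDeriv g s / radialCoeff g s) / radialCoeff g s

/-- The analytic extension to `s = 0` of `s |A|²` of the spheres. -/
noncomputable def curvatureProfile (g : ℝ → ℝ) (d : ℕ) (s : ℝ) : ℝ :=
  ((d - 1) * (s * radialCoeff g s / (1 + s * deriv g s)) ^ 2
    + (1 + s * radialCoeffDeriv g s / radialCoeff g s) ^ 2) / radialCoeff g s

/-- The poles of `log s` cancel in the first two expressions; in the third, the pole of the
denominator becomes a zero of the quotient. -/
theorem profile_identities {s : ℝ} (hs : 0 < s) :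
    s⁻¹ + deriv g s + s * (-(s ^ 2)⁻¹ + deriv (deriv g) s) = radialCoeff g s ∧
    2 * (-(s ^ 2)⁻¹ + deriv (deriv g) s) + s * (2 * (s ^ 3)⁻¹ + deriv (deriv (deriv g)) s) =
      radialCoeffDeriv g s ∧
    radialCoeff g s / (s⁻¹ + deriv g s) = s * radialCoeff g s / (1 + s * deriv g s) := by
  refine ⟨?_, ?_, ?_⟩
  · rw [radialCoeff]; field_simp; ring
  · rw [radialCoeffDeriv]; field_simp; ring
  · have : 1 + s * deriv g s = s * (s⁻¹ + deriv g s) := by field_simp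
    rw [this, mul_div_mul_left _ _ hs.ne']

theorem radialSpeed_eq_speedProfile (d : ℕ) {s : ℝ} (hs : 0 < s) :
    radialSpeed (fun s => s⁻¹ + deriv g s) (fun s => -(s ^ 2)⁻¹ + deriv (deriv g) s)
      (fun s => 2 * (s ^ 3)⁻¹ + deriv (deriv (deriv g)) s) d s = speedProfile g d s := by
  obtain ⟨e1, e2, e3⟩ := profile_identities (g := g) hs
  simp only [radialSpeed, e1, e2, e3, speedProfile]

theorem sphereNormSqA_eq_curvatureProfile (d : ℕ) {s : ℝ} (hs : 0 < s) :
    sphereNormSqA (fun s => s⁻¹ + deriv g s) (fun s => -(s ^ 2)⁻¹ + deriv (deriv g) s)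
      (fun s => 2 * (s ^ 3)⁻¹ + deriv (deriv (deriv g)) s) d s = curvatureProfile g d s / s := by
  obtain ⟨e1, e2, e3⟩ := profile_identities (g := g) hs
  simp only [sphereNormSqA, e1, e2, e3, curvatureProfile, div_div]

/-- Only the two denominators matter. For `s > 0` they are nonzero by the positivity of the metric,
and at `s = 0` they equal `deriv g 0` and `1`. -/
theorem analyticAt_profiles (hg : AnalyticOnNhd ℝ g (Ici 0)) (h0 : 0 < deriv g 0)
    (h1 : ∀ s : ℝ, 0 < s → 0 < 1 / s + deriv g s)
    (h2 : ∀ s : ℝ, 0 < s → 0 < deriv g s + s * deriv (deriv g) s) (d : ℕ) {s : ℝ} (hs : 0 ≤ s) :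
    AnalyticAt ℝ (speedProfile g d) s ∧ AnalyticAt ℝ (curvatureProfile g d) s := by
  have a1 : AnalyticAt ℝ (deriv g) s := (hg s hs).deriv
  have a2 := a1.deriv
  have a3 := a2.deriv
  have aid : AnalyticAt ℝ (fun s : ℝ => s) s := analyticAt_id
  have al : AnalyticAt ℝ (radialCoeff g) s := a1.add (aid.mul a2)
  have al' : AnalyticAt ℝ (radialCoeffDeriv g) s := (analyticAt_const.mul a2).add (aid.mul a3)
  have aq : AnalyticAt ℝ (fun s => 1 + s * deriv g s) s := analyticAt_const.add (aid.mul a1)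
  have hl : radialCoeff g s ≠ 0 := by
    rcases hs.eq_or_lt with rfl | hs
    · simpa [radialCoeff] using h0.ne'
    · exact (h2 s hs).ne'
  have hq : 1 + s * deriv g s ≠ 0 := by
    rcases hs.eq_or_lt with rfl | hs
    · simp
    · have : 1 + s * deriv g s = s * (1 / s + deriv g s) := by field_simp
      rw [this]
      exact (mul_pos hs (h1 s hs)).ne'
  have aα := (aid.mul al).div aq hq
  have aκ := (aid.mul al').div al hl
  exact ⟨(((analyticAt_const.mul aα).add analyticAt_const).add aκ).div al hl,
    ((analyticAt_const.mul (aα.pow 2)).add ((analyticAt_const.add aκ).pow 2)).div al hl⟩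

end Profile

theorem range_smul_coe_sphere {m : ℕ} {r : ℝ} (hr : 0 < r) :
    range (fun x : UnitSphere m => r • (x : Cm m)) = hypersphere m r := by
  ext z
  rw [hypersphere, mem_ofPred_eq, S_eq_norm_sq, sq_eq_sq₀ (norm_nonneg _) hr.le]
  constructor
  · rintro ⟨x, rfl⟩
    simp [norm_smul, abs_of_pos hr]
  · intro hz
    refine ⟨⟨r⁻¹ • z, ?_⟩, ?_⟩
    · simp [norm_smul, hz, abs_of_pos hr, hr.ne']
    · simp [smul_smul, hr.ne']

/-- `s ↦ K(s) / s` along a function decreasing to zero at least linearly is of Type I. -/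
theorem isTypeISingularity_of_eq_div {E : Type*} [NormedAddCommGroup E] [NormedSpace ℝ E] {d : ℕ}
    {N : Type*} [TopologicalSpace N] [ChartedSpace (EuclideanSpace ℝ (Fin d)) N] [Nonempty N]
    {G : E → E → E → ℝ} {T c s₀ : ℝ} {F ν : ℝ → N → E} {s κ : ℝ → ℝ} (hT : 0 < T) (hc : 0 < c)
    (hs : ∀ t ∈ Ico 0 T, 0 < s t ∧ s t ≤ s₀ ∧ c * (T - t) ≤ s t)
    (hlim : Tendsto s (𝓝[<] T) (𝓝 0)) (hκ : ContinuousOn κ (Icc 0 s₀)) (hκ0 : ContinuousAt κ 0)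
    (hκpos : 0 < κ 0)
    (hA : ∀ t ∈ Ico 0 T, ∀ p, normSqA d G (F t) (ν t) p = κ (s t) / s t) :
    IsTypeISingularity d G T F ν := by
  have hev : ∀ᶠ t in 𝓝[<] T, t ∈ Ico 0 T := Ico_mem_nhdsLT hT
  constructor
  · intro K
    have hlim0 : Tendsto s (𝓝[<] T) (𝓝[>] 0) :=
      tendsto_nhdsWithin_iff.mpr ⟨hlim, hev.mono fun t ht => (hs t ht).1⟩
    have h1 : Tendsto (fun t => κ (s t) / s t) (𝓝[<] T) atTop := by
      simp only [div_eq_mul_inv]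
      exact (hκ0.tendsto.comp hlim).pos_mul_atTop hκpos (tendsto_inv_nhdsGT_zero.comp hlim0)
    filter_upwards [hev, h1.eventually_gt_atTop K] with t ht hK
    exact ⟨Classical.arbitrary N, by rwa [hA t ht]⟩
  · obtain ⟨M, hM⟩ := (isCompact_Icc.image_of_continuousOn hκ).bddAbove
    have hM' : ∀ t ∈ Ico 0 T, κ (s t) ≤ max M 0 := fun t ht =>
      (hM ⟨s t, ⟨(hs t ht).1.le, (hs t ht).2.1⟩, rfl⟩).trans (le_max_left _ _)
    refine ⟨max M 0 / c + 2, ?_, fun t ht p => ?_⟩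
    · have : 0 ≤ max M 0 / c := div_nonneg (le_max_right _ _) hc.le
      linarith
    · obtain ⟨hpos, -, hlin⟩ := hs t ht
      have hTt : 0 < T - t := sub_pos.mpr ht.2
      rw [hA t ht]
      calc κ (s t) / s t ≤ max M 0 / s t := by gcongr; exact hM' t ht
        _ ≤ max M 0 / (c * (T - t)) := by gcongr
        _ = max M 0 / c / (T - t) := by rw [div_div]
        _ ≤ (max M 0 / c + 2) / (T - t) := by gcongr; linarith

end KahlerMCF

/-! ### Assembly of the theorem. -/

theorem mainTheorem1 (m : ℕ) [NeZero m] (g : ℝ → ℝ)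
    (hg : AnalyticOnNhd ℝ g (Set.Ici 0))
    (h0 : 0 < deriv g 0)
    (h1 : ∀ s : ℝ, 0 < s → 0 < 1 / s + deriv g s)
    (h2 : ∀ s : ℝ, 0 < s → 0 < deriv g s + s * deriv (deriv g) s) :
    ∃ ε : ℝ, 0 < ε ∧ ∀ R₀ : ℝ, 0 < R₀ → R₀ < ε →
      ∃ T : ℝ, 0 < T ∧ ∃ F ν : ℝ → UnitSphere m → Cm m,
        -- a mean curvature flow on `[0, T)`, starting at `Σ_{R₀}`, through hyperspheres
        IsMeanCurvatureFlow (2 * m - 1) {0}ᶜ (blowUpMetric m g) T F ν ∧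
        (∀ x : UnitSphere m, F 0 x = R₀ • (x : Cm m)) ∧
        (∃ R : ℝ → ℝ, ∀ t ∈ Set.Ico 0 T, 0 < R t ∧ Set.range (F t) = hypersphere m (R t)) ∧
        -- it is the only one, and it cannot be continued beyond `T`
        (∀ (T' : ℝ) (F' ν' : ℝ → UnitSphere m → Cm m),
          IsMeanCurvatureFlow (2 * m - 1) {0}ᶜ (blowUpMetric m g) T' F' ν' →
          (∀ x : UnitSphere m, F' 0 x = R₀ • (x : Cm m)) →
          T' ≤ T ∧ ∀ t ∈ Set.Ico 0 T', F' t = F t) ∧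
        -- it collapses onto the exceptional divisor, with a singularity of Type I
        SetsConverge (fun t => (blowDown ⁻¹' Set.range (F t) : Set (BlowUp m))) T
          (exceptionalDivisor m) ∧
        IsTypeISingularity (2 * m - 1) (blowUpMetric m g) T F ν := by
  have hK : IsRadialKahler (complexStructure m) _ _ _ (blowUpMetric m g) :=
    isRadialKahler_blowUpMetric hg h1 h2
  set d := 2 * m - 1 with hd
  have hfin : Fact (Module.finrank ℝ (Cm m) = d + 1) := finrank_Cm m
  have hρ : ∀ s, 0 < s → radialSpeed _ _ _ d s = speedProfile g d s := fun s hs =>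
    radialSpeed_eq_speedProfile (g := g) d hs
  have han : ∀ s : ℝ, 0 ≤ s → _ := fun s hs => analyticAt_profiles hg h0 h1 h2 d hs
  have hρ0 : 0 < speedProfile g d 0 := by
    simpa [speedProfile, radialCoeff] using h0
  have hκ0 : 0 < curvatureProfile g d 0 := by
    simpa [curvatureProfile, radialCoeff] using h0
  -- Analyticity and positivity of the speed on a two-sided neighbourhood of `0` let the solution
  -- cross `s = 0`. Halving `δ` gives a closed interval inside the ball, and `ε = √(δ / 2)` because
  -- the variable is the squared radius.
  obtain ⟨δ, hδ, hball⟩ := Metric.eventually_nhds_iff_ball.mp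
    ((han 0 le_rfl).1.eventually_analyticAt.and
      ((han 0 le_rfl).1.continuousAt.eventually (lt_mem_nhds hρ0)))
  have hIcc : ∀ s ∈ Icc (-(δ / 2)) (δ / 2), s ∈ Metric.ball (0 : ℝ) δ := fun s hs => by
    rw [mem_ball_zero_iff, Real.norm_eq_abs]
    exact (abs_le.mpr hs).trans_lt (by linarith)
  refine ⟨√(δ / 2), Real.sqrt_pos.mpr (by linarith), fun R₀ hR₀ hR₀ε => ?_⟩
  have hR₀δ : R₀ ^ 2 < δ / 2 := (Real.lt_sqrt hR₀.le).mp hR₀ε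
  obtain ⟨T, c, s, hT, hc, hsc, hs0, hsT, hsol⟩ := exists_solution_reaching_zero
    (Φ := fun s => 2 * speedProfile g d s) (δ := δ / 2) (s₀ := R₀ ^ 2) (by positivity) hR₀δ
    (fun s hs => (contDiffAt_const.mul
      (hball s (hIcc s hs)).1.contDiffAt).contDiffWithinAt)
    (fun s hs => mul_pos two_pos (hball s (hIcc s hs)).2)
  have hs : ∀ t ∈ Ico 0 T, 0 < s t ∧ HasDerivAt s (-(2 * speedProfile g d (s t))) t := fun t ht =>
    ⟨(hsol t ht).1, (hsol t ht).2.2.1⟩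
  have hlim : Tendsto s (𝓝[<] T) (𝓝 0) := hsT ▸ hsc.continuousWithinAt
  have hsqrt0 : √(s 0) = R₀ := by rw [hs0, Real.sqrt_sq hR₀.le]
  have hρs : ContDiffOn ℝ 1 (speedProfile g d) (Ioi 0) := fun s hs =>
    (han s (le_of_lt hs)).1.contDiffAt.contDiffWithinAt
  have hrange : ∀ t ∈ Ico 0 T, 0 < √(s t) ∧
      range (fun x : UnitSphere m => √(s t) • (x : Cm m)) = hypersphere m (√(s t)) := fun t ht =>
    ⟨Real.sqrt_pos.mpr (hs t ht).1, range_smul_coe_sphere (Real.sqrt_pos.mpr (hs t ht).1)⟩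
  have : Nonempty (UnitSphere m) :=
    ⟨⟨EuclideanSpace.single ⟨0, Nat.pos_of_ne_zero (NeZero.ne m)⟩ 1, by simp⟩⟩
  have x₀ : UnitSphere m := Classical.arbitrary _
  have hsqrtlim : Tendsto (fun t => √(s t)) (𝓝[<] T) (𝓝 0) := by
    have h := (Real.continuous_sqrt.tendsto 0).comp hlim
    rwa [Real.sqrt_zero] at h
  refine ⟨T, hT, fun t x => √(s t) • (x : Cm m), _,
    hK.isMeanCurvatureFlow_spheres hρ hs (fun t ht => (hsol t ht).2.2.2.1),
    fun x => congrArg (· • (x : Cm m)) hsqrt0, ⟨fun t => √(s t), hrange⟩, fun T' F' ν' hF' hF'0 => ?_,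
    setsConverge_exceptionalDivisor ?_ hsqrtlim,
    isTypeISingularity_of_eq_div (κ := curvatureProfile g d) hT hc
      (fun t ht => ⟨(hsol t ht).1, (hsol t ht).2.1, (hsol t ht).2.2.2.2⟩) hlim
      (fun s hs => (han s hs.1).2.continuousAt.continuousWithinAt) (han 0 le_rfl).2.continuousAt
      hκ0 (fun t ht p => ?_)⟩
  · have heq : ∀ t ∈ Ico 0 T, t < T' → ∀ x, F' t x = √(s t) • (x : Cm m) := fun t ht ht' x => by
      rw [hK.eq_smul_of_flow hfin.out hρ hρs hs hF' (fun p => by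
        rw [hF'0, ← hsqrt0, norm_sq_smul_coe_sphere (hs 0 ⟨le_rfl, hT⟩).1.le]) ht ht' x, hF'0,
        smul_smul, hsqrt0, div_mul_cancel₀ _ hR₀.ne']
    have hle : T' ≤ T := by
      -- If the second flow existed at time `T`, continuity would give `F' T x₀ = 0`, a point
      -- outside the domain of the metric.
      by_contra! hlt
      have hcont : ContinuousWithinAt (fun t => F' t x₀) (Ico 0 T') T :=
        (hF'.evolution T ⟨hT.le, hlt⟩ x₀).continuousWithinAt
      have h3 : Tendsto (fun t => F' t x₀) (𝓝[<] T) (𝓝 (F' T x₀)) :=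
        hcont.mono_left (nhdsWithin_le_of_mem (mem_of_superset (Ico_mem_nhdsLT hT)
          (Ico_subset_Ico_right hlt.le)))
      have h4 : Tendsto (fun t => F' t x₀) (𝓝[<] T) (𝓝 0) := by
        have h5 : Tendsto (fun t => √(s t) • (x₀ : Cm m)) (𝓝[<] T) (𝓝 0) := by
          simpa using hsqrtlim.smul_const (x₀ : Cm m)
        refine h5.congr' ?_
        filter_upwards [Ico_mem_nhdsLT hT] with t ht using (heq t ht (ht.2.trans hlt) x₀).symm
      exact hF'.mem T ⟨hT.le, hlt⟩ x₀ (tendsto_nhds_unique h3 h4)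
    exact ⟨hle, fun t ht => funext fun x => heq t ⟨ht.1, ht.2.trans_le hle⟩ ht.2 x⟩
  · filter_upwards [Ico_mem_nhdsLT hT] with t ht using ⟨(hrange t ht).1.le, (hrange t ht).2⟩
  · rw [hK.normSqA_sphere (hs t ht).1 p]
    exact sphereNormSqA_eq_curvatureProfile d (hs t ht).1
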